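/- **Conventions.** $(X,\mathbf d)$ is a nonempty complete metric space. A ball is a closed ball given by a centre and a radius $\mathrm{rad}>0$, and $B(x,r)\subseteq B(y,s)$ is understood formally as $\mathbf d(x,y)+r\le s$. *Schmidt's game and the weak game.* Let $\alpha,\beta\in(0,1)$. Bob chooses a ball $B_0$; then Alice and Bob alternately choose balls $B_0\supseteq A_1\supseteq B_1\supseteq A_2\supseteq\cdots$ with $\mathrm{rad}(B_{i+1})=\beta\,\mathrm{rad}(A_{i+1})$ and $\mathrm{rad}(A_{i+1})=\alpha\,\mathrm{rad}(B_i)$ (Schmidt's $(\alpha,\beta)$ game), respectively $\mathrm{rad}(A_{i+1})\ge\alpha\,\mathrm{rad}(B_i)$ (weak $(\alpha,\beta)$ game). A set $S\subseteq X$ is *(weak) winning* if there is $\alpha\in(0,1)$ such that for every $\beta\in(0,1)$ Alice has a strategy in the (weak) $(\alpha,\beta)$ game ensuring $\bigcap_i B_i\subseteq S$. *Potential game.* Let $c,\beta>0$. Bob chooses a ball $B_0$. In response to $B_i$, Alice chooses a countable collection of balls $A_{i+1,k}$ with $\sum_k\mathrm{rad}(A_{i+1,k})^c\le(\beta\,\mathrm{rad}(B_i))^c$,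 and then Bob chooses a ball $B_{i+1}\subseteq B_i$ with $\mathrm{rad}(B_{i+1})\ge\beta\,\mathrm{rad}(B_i)$. Alice wins if $\mathrm{rad}(B_i)\not\to0$, or $\bigcap_iB_i\subseteq\bigcup_{i,k}A_{i,k}$, or $\bigcap_iB_i\subseteq E$. The set $E$ is *$c_0$ potential winning* if Alice has a winning strategy for all $c>c_0$ and $\beta>0$. *Ahlfors regularity.* $X$ is *$\delta$ Ahlfors regular* ($\delta>0$) if there are a Borel measure $\mu$ on $X$ and $C,r_0>0$ with $\frac1Cr^\delta\le\mu(B(x,r))\le Cr^\delta$ for all $x\in X$, $0<r\le r_0$. In such a space $E$ is *potential winning* if it is $c_0$ potential winning for some $0\le c_0<\delta$. *Cantor winning.* In $\mathbb R^N$ with the maximum norm, balls are axis-parallel cubes (boxes). For a box $B$ and an integer $u\ge1$ let $\mathcal S(B,u)$ be the set of the $u^N$ equal boxes of radius $\mathrm{rad}(B)/u$ into which $B$ is cut, and $\frac1u\mathcal B=\bigcup_{B\in\mathcal B}\mathcal S(B,u)$. Given a box $B_0$, an integer $R\ge1$ and reals $r_{m,n}\ge0$ $(0\le m\le n)$, a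 $(B_0,R,(r_{m,n}))$ *Cantor set* is a set $\bigcap_n\bigcup_{B\in\mathcal B_n}B$, where $\mathcal B_0=\{B_0\}$, $\mathcal B_{n+1}=\frac1R\mathcal B_n\setminus\bigcup_{m\le n}\mathcal A_{m,n}$, with $\mathcal A_{m,n}\subseteq\frac1{R^{n-m+1}}\mathcal B_m$ and $\#\{A\in\mathcal A_{m,n}:A\subseteq B\}\le r_{m,n}$ for all $B\in\mathcal B_m$. A set $E\subseteq\mathbb R^N$ is *Cantor winning* if for some $\varepsilon_0\in(0,1]$, for every box $B_0$ and every $0<\varepsilon<\varepsilon_0$ there is $R_\varepsilon\geq 1$ such that for every integer $R\ge R_\varepsilon$ the set $E$ contains a $(B_0,R,(r_{m,n}))$ Cantor set with $r_{m,n}\le (R^{N})^{(n-m+1)(1-\varepsilon)}$ for all $0\le m\le n$. **Theorem.** 1. Let $S\subseteq\mathbb R^N$ be winning or weak winning, the game being played with the balls of the maximum norm or with those of the Euclidean norm, and let $E\subseteq\mathbb R^N$ be Cantor winning. Then $\dim_H(S\cap E)=N$. 2. Let $X$ be a nonempty complete $\delta$ Ahlfors regular metric space, let $S\subseteq X$ be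 winning or weak winning, and let $E\subseteq X$ be potential winning. Then $S\cap E$ has full Hausdorff dimension: $\dim_H(S\cap E)=\dim_HX$, and if $X$ is separable then $\dim_H(S\cap E)=\delta$. -/

import Mathlib

open Set Filter Topology MeasureTheory
open scoped ENNReal

/-- A closed ball of a metric space, recorded as a centre together with a positive radius
(in a general metric space the underlying set does not determine them). -/
@[ext]
structure CBall (X : Type*) where
  center : X
  radius : ℝ
  radius_pos : 0 < radius

namespace CBall

variable {X : Type*} [MetricSpace X]

/-- The set of points of a ball. -/
def carrier (B : CBall X) : Set X := Metric.closedBall B.center B.radius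

/-- Containment of balls, expressed by the distance inequality between centres and radii that
formally guarantees the inclusion of the underlying sets. -/
def Inside (A B : CBall X) : Prop := dist A.center B.center + A.radius ≤ B.radius

theorem Inside.carrier_subset {A B : CBall X} (h : A.Inside B) : A.carrier ⊆ B.carrier :=
  Metric.closedBall_subset_closedBall' (by unfold Inside at h; linarith)

end CBall

/-! ### Schmidt's game and the weak game -/

section Games

variable {X : Type*} [MetricSpace X]

/-- `E` is `(α, β)` winning for Schmidt's game: Alice has a strategy `σ`, which answers each
finite sequence `B₀, …, Bₙ` of Bob's moves by a ball `Aₙ₊₁ ⊆ Bₙ` of radius `α · rad Bₙ`, such that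
whenever Bob plays balls `Bₙ₊₁ ⊆ Aₙ₊₁` of radius `β · rad Aₙ₊₁`, the outcome lies in `E`. -/
def IsSchmidtWinning (α β : ℝ) (E : Set X) : Prop :=
  ∃ σ : (n : ℕ) → (Fin (n + 1) → CBall X) → CBall X,
    (∀ n h, (σ n h).Inside (h (Fin.last n)) ∧ (σ n h).radius = α * (h (Fin.last n)).radius) ∧
    ∀ B : ℕ → CBall X,
      (∀ n, (B (n + 1)).Inside (σ n fun i => B i) ∧
        (B (n + 1)).radius = β * (σ n fun i => B i).radius) →
      ⋂ n, (B n).carrier ⊆ E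

/-- `E` is `(α, β)` winning for the weak game: as in Schmidt's game, but Alice may play any ball
`Aₙ₊₁ ⊆ Bₙ` of radius at least `α · rad Bₙ`. -/
def IsWeakSchmidtWinning (α β : ℝ) (E : Set X) : Prop :=
  ∃ σ : (n : ℕ) → (Fin (n + 1) → CBall X) → CBall X,
    (∀ n h, (σ n h).Inside (h (Fin.last n)) ∧ α * (h (Fin.last n)).radius ≤ (σ n h).radius) ∧
    ∀ B : ℕ → CBall X,
      (∀ n, (B (n + 1)).Inside (σ n fun i => B i) ∧
        (B (n + 1)).radius = β * (σ n fun i => B i).radius) →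
      ⋂ n, (B n).carrier ⊆ E

/-- `E` is winning for Schmidt's game. -/
def IsWinning (E : Set X) : Prop :=
  ∃ α : ℝ, 0 < α ∧ α < 1 ∧ ∀ β : ℝ, 0 < β → β < 1 → IsSchmidtWinning α β E

/-- `E` is winning for the weak game. -/
def IsWeakWinning (E : Set X) : Prop :=
  ∃ α : ℝ, 0 < α ∧ α < 1 ∧ ∀ β : ℝ, 0 < β → β < 1 → IsWeakSchmidtWinning α β E

/-! ### The potential game -/

/-- `E` is `(c, β)` potential winning: Alice has a strategy `σ`, which answers each finite sequence
`B₀, …, Bₙ` of Bob's moves by a countable collection of closed balls `A` with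
`∑ rad(A) ^ c ≤ (β · rad Bₙ) ^ c`, such that for every sequence of balls `Bₙ₊₁ ⊆ Bₙ` with
`rad Bₙ₊₁ ≥ β · rad Bₙ`, either the radii do not tend to `0`, or the outcome is covered by the
balls chosen by Alice, or the outcome lies in `E`. -/
def IsPotentialWinningParam (c β : ℝ) (E : Set X) : Prop :=
  ∃ σ : (n : ℕ) → (Fin (n + 1) → CBall X) → Set (CBall X),
    (∀ n h, (σ n h).Countable ∧
      ∑' A : σ n h, ENNReal.ofReal ((A : CBall X).radius ^ c) ≤
        ENNReal.ofReal ((β * (h (Fin.last n)).radius) ^ c)) ∧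
    ∀ B : ℕ → CBall X,
      (∀ n, (B (n + 1)).Inside (B n) ∧ β * (B n).radius ≤ (B (n + 1)).radius) →
      ¬ Tendsto (fun n => (B n).radius) atTop (𝓝 0) ∨
      ⋂ n, (B n).carrier ⊆ ⋃ n, ⋃ A ∈ σ n (fun i => B i), A.carrier ∨
      ⋂ n, (B n).carrier ⊆ E

/-- `E` is `c₀` potential winning. -/
def IsPotentialWinningAt (c₀ : ℝ) (E : Set X) : Prop :=
  ∀ c β : ℝ, c₀ < c → 0 < β → IsPotentialWinningParam c β E

/-- `E` is potential winning in a space that is Ahlfors regular of dimension `δ`. -/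
def IsPotentialWinning (δ : ℝ) (E : Set X) : Prop :=
  ∃ c₀ : ℝ, 0 ≤ c₀ ∧ c₀ < δ ∧ IsPotentialWinningAt c₀ E

end Games

/-- The space `X` carries a Borel measure that is Ahlfors regular of dimension `δ > 0`.
(The lower bound forces the support of the measure to be all of `X`.) -/
def IsAhlforsRegular (X : Type*) [MetricSpace X] [MeasurableSpace X] [BorelSpace X]
    (δ : ℝ) : Prop :=
  0 < δ ∧ ∃ μ : Measure X, ∃ C r₀ : ℝ, 0 < C ∧ 0 < r₀ ∧
    ∀ (x : X) (r : ℝ), 0 < r → r ≤ r₀ →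
      ENNReal.ofReal (1 / C * r ^ δ) ≤ μ (Metric.closedBall x r) ∧
      μ (Metric.closedBall x r) ≤ ENNReal.ofReal (C * r ^ δ)

/-! ### Splitting structures and Cantor winning sets -/

/-- A splitting structure `(X, 𝒮, U, f)`. The values of `split B u` and `f u` matter only for
`u ∈ U`. -/
structure SplittingStructure (X : Type*) [MetricSpace X] where
  U : Set ℕ
  f : ℕ → ℕ
  split : CBall X → ℕ → Set (CBall X)
  U_infinite : U.Infinite
  U_pos : ∀ u ∈ U, 0 < u
  mul_mem : ∀ u ∈ U, ∀ v ∈ U, u * v ∈ U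
  div_mem : ∀ u ∈ U, ∀ v ∈ U, u ∣ v → v / u ∈ U
  f_pos : ∀ u ∈ U, 0 < f u
  f_mul : ∀ u ∈ U, ∀ v ∈ U, f (u * v) = f u * f v
  split_inside : ∀ B, ∀ u ∈ U, ∀ A ∈ split B u, A.Inside B ∧ A.radius = B.radius / u
  encard_split : ∀ B, ∀ u ∈ U, (split B u).encard = (f u : ℕ∞)
  separated : ∀ B, ∀ u ∈ U, ∀ A ∈ split B u, ∀ A' ∈ split B u, A ≠ A' →
    A.radius + A'.radius ≤ dist A.center A'.center
  split_mul : ∀ B, ∀ u ∈ U, ∀ v ∈ U, split B (u * v) = ⋃ A ∈ split B u, split A v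

namespace SplittingStructure

variable {X : Type*} [MetricSpace X] (𝒮 : SplittingStructure X)

/-- The collection `(1/R) 𝓑` of all balls obtained by splitting the members of `𝓑`. -/
def splitAll (𝓑 : Set (CBall X)) (R : ℕ) : Set (CBall X) := ⋃ B ∈ 𝓑, 𝒮.split B R

/-- `K` is a `(B₀, R, r)` Cantor set: `𝓑 n` are the surviving balls of level `n` and `𝓐 m n`, for
`m ≤ n`, are the collections of removed balls. -/
def IsCantorSet (B₀ : CBall X) (R : ℕ) (r : ℕ → ℕ → ℝ) (K : Set X) : Prop :=
  ∃ (𝓑 : ℕ → Set (CBall X)) (𝓐 : ℕ → ℕ → Set (CBall X)),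
    𝓑 0 = {B₀} ∧
    (∀ n, 𝓑 (n + 1) = 𝒮.splitAll (𝓑 n) R \ ⋃ m ≤ n, 𝓐 m n) ∧
    (∀ m n, m ≤ n → 𝓐 m n ⊆ 𝒮.splitAll (𝓑 m) (R ^ (n - m + 1))) ∧
    (∀ m n, m ≤ n → ∀ B ∈ 𝓑 m,
      {A ∈ 𝓐 m n | A.Inside B}.Finite ∧ ({A ∈ 𝓐 m n | A.Inside B}.ncard : ℝ) ≤ r m n) ∧
    K = ⋂ n, ⋃ B ∈ 𝓑 n, B.carrier

/-- `E` is `ε₀` Cantor winning on the ball `B₀`. -/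
def IsCantorWinningOn (ε₀ : ℝ) (B₀ : CBall X) (E : Set X) : Prop :=
  ∀ ε : ℝ, 0 < ε → ε < ε₀ → ∃ Rε ∈ 𝒮.U, ∀ R ∈ 𝒮.U, Rε ≤ R →
    ∃ (r : ℕ → ℕ → ℝ) (K : Set X),
      (∀ m n, m ≤ n → 0 ≤ r m n ∧
        r m n ≤ (𝒮.f R : ℝ) ^ (((n : ℝ) - (m : ℝ) + 1) * (1 - ε))) ∧
      𝒮.IsCantorSet B₀ R r K ∧ K ⊆ E

/-- `E` is Cantor winning. -/
def IsCantorWinning (E : Set X) : Prop :=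
  ∃ ε₀ : ℝ, 0 < ε₀ ∧ ε₀ ≤ 1 ∧ ∀ B₀ : CBall X, 𝒮.IsCantorWinningOn ε₀ B₀ E

end SplittingStructure

/-! ### The standard splitting structure on `ℝ^N` with the maximum norm -/

/-- The box with index `k` among the `u ^ N` equal boxes into which the box `B` is cut. -/
noncomputable def subBox {N : ℕ} (B : CBall (Fin N → ℝ)) (u : ℕ) (hu : 0 < u)
    (k : Fin N → Fin u) : CBall (Fin N → ℝ) where
  center := fun i => B.center i - B.radius + (2 * ((k i : ℕ) : ℝ) + 1) * (B.radius / u)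
  radius := B.radius / u
  radius_pos := div_pos B.radius_pos (by exact_mod_cast hu)

/-- The boxes of side `1 / u` times that of `B` into which the box `B` is cut. -/
def boxSplit {N : ℕ} (B : CBall (Fin N → ℝ)) (u : ℕ) : Set (CBall (Fin N → ℝ)) :=
  {A | ∃ (hu : 0 < u) (k : Fin N → Fin u), A = subBox B u hu k}

theorem subBox_separated {N : ℕ} (B : CBall (Fin N → ℝ)) (u : ℕ) (hu : 0 < u)
    (k l : Fin N → Fin u) (hkl : k ≠ l) :
    B.radius / u + B.radius / u ≤ dist (subBox B u hu k).center (subBox B u hu l).center := by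
  obtain ⟨i, hi⟩ := Function.ne_iff.1 hkl
  have hq : 0 < B.radius / u := (subBox B u hu k).radius_pos
  refine le_trans ?_ (dist_le_pi_dist _ _ i)
  have h1 : (1 : ℝ) ≤ |((k i : ℕ) : ℝ) - ((l i : ℕ) : ℝ)| := by
    have h2 : ((k i : ℕ) : ℤ) - ((l i : ℕ) : ℤ) ≠ 0 := by
      intro h
      apply hi
      apply Fin.ext
      omega
    have h3 := Int.one_le_abs h2
    exact_mod_cast h3
  have h4 : (subBox B u hu k).center i - (subBox B u hu l).center i =
      (((k i : ℕ) : ℝ) - ((l i : ℕ) : ℝ)) * (2 * (B.radius / u)) := by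
    simp only [subBox]
    ring
  rw [Real.dist_eq, h4, abs_mul, abs_of_pos (by positivity : (0 : ℝ) < 2 * (B.radius / u))]
  nlinarith

theorem subBox_injective {N : ℕ} (B : CBall (Fin N → ℝ)) (u : ℕ) (hu : 0 < u) :
    Function.Injective (subBox B u hu) := by
  intro k l h
  by_contra hkl
  have h1 := subBox_separated B u hu k l hkl
  have hq : 0 < B.radius / u := (subBox B u hu k).radius_pos
  rw [h, dist_self] at h1
  linarith

theorem subBox_inside {N : ℕ} (B : CBall (Fin N → ℝ)) (u : ℕ) (hu : 0 < u)
    (k : Fin N → Fin u) : (subBox B u hu k).Inside B := by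
  have hu' : (0 : ℝ) < u := by exact_mod_cast hu
  have hu1 : (1 : ℝ) ≤ u := by exact_mod_cast hu
  have hB := B.radius_pos
  have hq : 0 < B.radius / u := div_pos hB hu'
  have hqu : B.radius / u * u = B.radius := by field_simp
  have hd : dist (subBox B u hu k).center B.center ≤ B.radius - B.radius / u := by
    refine (dist_pi_le_iff (by nlinarith)).2 fun i => ?_
    have hk0 : (0 : ℝ) ≤ ((k i : ℕ) : ℝ) := Nat.cast_nonneg _
    have hk1 : ((k i : ℕ) : ℝ) + 1 ≤ u := by exact_mod_cast (k i).2
    rw [Real.dist_eq, abs_le]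
    simp only [subBox]
    constructor <;> nlinarith
  have hr : (subBox B u hu k).radius = B.radius / u := rfl
  unfold CBall.Inside
  rw [hr]
  linarith

theorem boxSplit_eq_range {N : ℕ} (B : CBall (Fin N → ℝ)) (u : ℕ) (hu : 0 < u) :
    boxSplit B u = range (subBox B u hu) := by
  ext A
  constructor
  · rintro ⟨_, k, rfl⟩
    exact ⟨k, rfl⟩
  · rintro ⟨k, rfl⟩
    exact ⟨hu, k, rfl⟩

theorem boxSplit_mul {N : ℕ} (B : CBall (Fin N → ℝ)) (u v : ℕ) (hu : 0 < u) (hv : 0 < v) :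
    boxSplit B (u * v) = ⋃ A ∈ boxSplit B u, boxSplit A v := by
  have hu' : (u : ℝ) ≠ 0 := by exact_mod_cast hu.ne'
  have hv' : (v : ℝ) ≠ 0 := by exact_mod_cast hv.ne'
  have key : ∀ (k : Fin N → Fin u) (l : Fin N → Fin v) (m : Fin N → Fin (u * v)),
      (∀ i, (m i : ℕ) = (k i : ℕ) * v + (l i : ℕ)) →
      subBox B (u * v) (Nat.mul_pos hu hv) m = subBox (subBox B u hu k) v hv l := by
    intro k l m hm
    apply CBall.ext
    · funext i
      simp only [subBox, hm i]
      push_cast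
      field_simp
      ring
    · simp only [subBox]
      push_cast
      field_simp
  ext A
  simp only [mem_iUnion, exists_prop]
  constructor
  · rintro ⟨huv, m, rfl⟩
    refine ⟨_, ⟨hu, fun i => ⟨(m i : ℕ) / v, ?_⟩, rfl⟩, hv,
      fun i => ⟨(m i : ℕ) % v, Nat.mod_lt _ hv⟩, key _ _ _ fun i => ?_⟩
    · exact Nat.div_lt_of_lt_mul ((m i).2.trans_eq (mul_comm u v))
    · exact (Nat.div_add_mod' _ _).symm
  · rintro ⟨_, ⟨_, k, rfl⟩, _, l, rfl⟩
    refine ⟨Nat.mul_pos hu hv, fun i => ⟨(k i : ℕ) * v + (l i : ℕ), ?_⟩,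
      (key _ _ _ fun i => rfl).symm⟩
    have h1 : ((k i : ℕ) + 1) * v ≤ u * v := Nat.mul_le_mul_right v (k i).2
    have h2 := (l i).2
    have h3 : ((k i : ℕ) + 1) * v = (k i : ℕ) * v + v := by ring
    omega

/-- The standard splitting structure on `ℝ^N` with the maximum norm: `U` is the set of all positive
integers, `f u = u ^ N`, and a box is cut into `u ^ N` equal boxes. -/
noncomputable def standardSplitting (N : ℕ) : SplittingStructure (Fin N → ℝ) where
  U := {u | 0 < u}
  f := fun u => u ^ N
  split := boxSplit
  U_infinite := Set.Ioi_infinite 0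
  U_pos := fun _ hu => hu
  mul_mem := fun _ hu _ hv => Nat.mul_pos hu hv
  div_mem := fun _ hu _ hv huv => Nat.div_pos (Nat.le_of_dvd hv huv) hu
  f_pos := fun _ hu => Nat.pow_pos hu
  f_mul := fun u _ v _ => Nat.mul_pow u v N
  split_inside := by
    rintro B u _ A ⟨hu, k, rfl⟩
    exact ⟨subBox_inside B u hu k, rfl⟩
  encard_split := by
    intro B u hu
    rw [boxSplit_eq_range B u hu, ← image_univ, (subBox_injective B u hu).encard_image,
      encard_univ, ENat.card_eq_coe_fintype_card]
    simp
  separated := by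
    rintro B u _ A ⟨hu, k, rfl⟩ A' ⟨_, l, rfl⟩ h
    exact subBox_separated B u hu k l fun hkl => h (by rw [hkl])
  split_mul := fun B u hu v hv => boxSplit_mul B u v hu hv

/-! Part 1 follows from part 2. With either norm `ℝ^N` is `N` Ahlfors regular (Haar measure), and
Cantor winning sets are potential winning (`exists_potential_reply`): when Bob's radius is
comparable to that of the level `m` boxes, Alice deletes all removed boxes of the families `𝓐 m n`
that lie in level `m` boxes near Bob's ball. At most `3 ^ N` boxes are near, and the sum over `n` is
geometric, with ratio a negative power of `R`.

For the lower bound in part 2, a winning set is weak winning, so let Bob play the weak game for `S`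
and the potential game for `E` at once, for an exponent `s` between `c₀` and `δ`. A move of ratio
`β` inside Alice's ball is a legal potential move of ratio at least `α * β`. The invariant is that
the deleted balls meeting Bob's ball `B` have total weight, measured by `rad ^ s`, at most `(α * β *
rad B) ^ s`. Alice's reply at most doubles this bound. Alice's ball has of order `β ^ (-δ)` well
separated candidates for Bob, no deleted ball meets two of them, and so at most `2 * (α * β) ^ (-s)`
of them violate the invariant. For small `β` at least `(α * β) ^ (-s)` good candidates remain.

This gives a tree of plays. Each branch ends in `S`, and it avoids every deleted ball, since a
deleted ball containing the limit would have radius at most `α * β` times radii tending to `0`;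
hence it ends in `E`. The branching number gives dimension at least `s`
(`le_dimH_range_of_separated`).

Covers by nets give the upper bound `δ` in the separable case. Otherwise both dimensions are
infinite: `S ∩ E` is dense, and a set of finite dimension is separable. -/

/-! ### A lower bound for the Hausdorff dimension of the branches of a tree -/

/-- If the points coded by two sequences of digits that differ first at place `n` have distance at
least `c * θ ^ n`, then the set of all coded points has dimension at least `s`, where
`M * θ ^ s ≥ 1`. -/
theorem le_dimH_range_of_separated {X : Type*} [MetricSpace X] {M : ℕ} (hM : 1 < M) {s θ c : ℝ}
    (hs : 0 < s) (hθ : 0 < θ) (hc : 0 < c) (hMs : 1 ≤ (M : ℝ) * θ ^ s) (g : (ℕ → Fin M) → X)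
    (hg : ∀ n a b, (∀ i < n, a i = b i) → a n ≠ b n → c * θ ^ n ≤ dist (g a) (g b)) :
    ENNReal.ofReal s ≤ dimH (range g) := by
  have hM0 : (0 : ℝ) < M := by exact_mod_cast (zero_lt_one.trans hM)
  have hfirst : ∀ a b : ℕ → Fin M, a ≠ b → ∃ n, (∀ i < n, a i = b i) ∧ a n ≠ b n := by
    intro a b hab
    have h := Function.ne_iff.1 hab
    classical
    exact ⟨Nat.find h, fun i hi => not_not.1 (Nat.find_min h hi), Nat.find_spec h⟩
  have hinj : Function.Injective g := by
    intro a b hab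
    by_contra hne
    obtain ⟨n, h1, h2⟩ := hfirst a b hne
    have h3 := hg n a b h1 h2
    rw [hab, dist_self] at h3
    have : 0 < c * θ ^ n := by positivity
    linarith
  have : NeZero M := ⟨by omega⟩
  -- Branches are read as expansions in base `M`, so the image is all of `[0, 1]`. Agreement up to
  -- place `n` bounds the difference by `M ^ (-n) ≤ (θ ^ n) ^ s`, which makes this map `s`-Hölder.
  let f : X → ℝ := fun x => Real.ofDigits (Function.invFun g x)
  have hfg : ∀ a, f (g a) = Real.ofDigits a := fun a => by
    simp only [f, Function.leftInverse_invFun hinj a]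
  have hH : HolderOnWith (Real.toNNReal ((c⁻¹) ^ s)) (Real.toNNReal s) f (range g) := by
    rintro _ ⟨a, rfl⟩ _ ⟨b, rfl⟩
    rw [hfg, hfg, edist_dist, edist_dist, Real.coe_toNNReal s hs.le,
      ENNReal.ofReal_rpow_of_nonneg dist_nonneg hs.le]
    change _ ≤ ENNReal.ofReal _ * _
    rw [← ENNReal.ofReal_mul (by positivity)]
    apply ENNReal.ofReal_le_ofReal
    rw [← Real.mul_rpow (by positivity) dist_nonneg]
    by_cases hab : a = b
    · subst hab
      simp only [dist_self]
      positivity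
    obtain ⟨n, h1, h2⟩ := hfirst a b hab
    have h3 := hg n a b h1 h2
    rw [Real.dist_eq]
    refine (Real.abs_ofDigits_sub_ofDigits_le h1).trans ?_
    have h4 : θ ^ n ≤ c⁻¹ * dist (g a) (g b) := by
      rw [inv_mul_eq_div, le_div_iff₀ hc]
      linarith
    refine le_trans ?_ (Real.rpow_le_rpow (by positivity) h4 hs.le)
    rw [inv_le_iff_one_le_mul₀ (by positivity), ← Real.rpow_natCast θ n, ← Real.rpow_mul hθ.le,
      mul_comm (n : ℝ) s, Real.rpow_mul hθ.le, Real.rpow_natCast, ← mul_pow, mul_comm]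
    exact one_le_pow₀ hMs
  have h1 := hH.dimH_image_le (Real.toNNReal_pos.2 hs)
  have h2 : Icc (0 : ℝ) 1 ⊆ f '' range g := by
    intro y hy
    obtain ⟨a, -, ha⟩ := Real.ofDigits_SurjOn hM hy
    exact ⟨g a, mem_range_self a, by rw [hfg, ha]⟩
  have h3 : dimH (Icc (0 : ℝ) 1) = 1 := by
    rw [Real.dimH_of_nonempty_interior (by rw [interior_Icc]; exact ⟨1 / 2, by norm_num⟩)]
    simp
  have h4 := (dimH_mono h2).trans h1
  rw [h3] at h4
  have h5 : (ENNReal.ofReal s) ≠ 0 := by simpa using hs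
  have h6 := (ENNReal.le_div_iff_mul_le (Or.inl h5) (Or.inl ENNReal.ofReal_ne_top)).1 h4
  rwa [one_mul] at h6

/-! ### Separated sets in Ahlfors regular spaces -/

/-- A separated set that is not yet a net can be enlarged by an uncovered point, and the bound `K`
stops this process. -/
theorem exists_maximal_separated_finset {X : Type*} [MetricSpace X] (s : Set X) {ε : ℝ}
    (hε : 0 < ε) (K : ℕ)
    (hK : ∀ T : Finset X, ↑T ⊆ s → (T : Set X).Pairwise (fun x y => ε ≤ dist x y) → T.card ≤ K) :
    ∃ T : Finset X, ↑T ⊆ s ∧ (T : Set X).Pairwise (fun x y => ε ≤ dist x y) ∧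
      s ⊆ ⋃ t ∈ T, Metric.closedBall t ε := by
  classical
  by_contra! h
  have : ∀ n : ℕ, ∃ T : Finset X, ↑T ⊆ s ∧ (T : Set X).Pairwise (fun x y => ε ≤ dist x y) ∧
      T.card = n := by
    intro n
    induction n with
    | zero => exact ⟨∅, by simp⟩
    | succ n ih =>
      obtain ⟨T, h1, h2, h3⟩ := ih
      obtain ⟨x, hx, hxT⟩ := not_subset.1 (h T h1 h2)
      simp only [mem_iUnion, Metric.mem_closedBall, not_exists, not_le] at hxT
      have hx' : x ∉ T := fun hxT' => by
        have := hxT x hxT'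
        rw [dist_self] at this
        linarith
      refine ⟨insert x T, ?_, ?_, by rw [Finset.card_insert_of_notMem hx', h3]⟩
      · rw [Finset.coe_insert]
        exact insert_subset hx h1
      · rw [Finset.coe_insert]
        refine h2.insert fun y hy _ => ⟨(hxT y hy).le, ?_⟩
        rw [dist_comm]
        exact (hxT y hy).le
  obtain ⟨T, h1, h2, h3⟩ := this (K + 1)
  have := hK T h1 h2
  omega

section Ahlfors

variable {X : Type*} [MetricSpace X] [MeasurableSpace X]

/-- The two-sided bound `r ^ δ / C ≤ μ (B(x, r)) ≤ C * r ^ δ` for all `0 < r ≤ r₀`. -/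
def AhlforsBounds (μ : Measure X) (δ C r₀ : ℝ) : Prop :=
  ∀ (x : X) (r : ℝ), 0 < r → r ≤ r₀ →
    ENNReal.ofReal (1 / C * r ^ δ) ≤ μ (Metric.closedBall x r) ∧
    μ (Metric.closedBall x r) ≤ ENNReal.ofReal (C * r ^ δ)

variable {μ : Measure X} {δ C r₀ : ℝ}

theorem AhlforsBounds.le_card_of_cover (h : AhlforsBounds μ δ C r₀) (hC : 0 < C)
    (x : X) {r ε : ℝ} (hr : 0 < r) (hr₀ : r ≤ r₀) (hε : 0 < ε) (hε₀ : ε ≤ r₀) (T : Finset X)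
    (hT : Metric.closedBall x r ⊆ ⋃ t ∈ T, Metric.closedBall t ε) :
    1 / C * r ^ δ ≤ T.card * (C * ε ^ δ) := by
  have h1 := ((h x r hr hr₀).1.trans (measure_mono hT)).trans (measure_biUnion_finset_le T _)
  have h2 : ∑ t ∈ T, μ (Metric.closedBall t ε) ≤ ∑ t ∈ T, ENNReal.ofReal (C * ε ^ δ) :=
    Finset.sum_le_sum fun t _ => (h t ε hε hε₀).2
  have h3 := h1.trans h2
  rw [Finset.sum_const, nsmul_eq_mul, ← ENNReal.ofReal_natCast,
    ← ENNReal.ofReal_mul (by positivity)] at h3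
  exact (ENNReal.ofReal_le_ofReal_iff (by positivity)).1 h3

variable [BorelSpace X]

/-- Balls of radius `ε / 3` about `ε`-separated points are disjoint, and the margin `ε / 3` keeps
them inside the ball of radius `r`. -/
theorem AhlforsBounds.card_le (h : AhlforsBounds μ δ C r₀) (hC : 0 < C)
    (x : X) {r ε : ℝ} (hr : 0 < r) (hr₀ : r ≤ r₀) (hε : 0 < ε) (hεr : ε ≤ r) (T : Finset X)
    (hT : ↑T ⊆ Metric.closedBall x (r - ε / 3))
    (hsep : (T : Set X).Pairwise fun x y => ε ≤ dist x y) :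
    (T.card : ℝ) * (1 / C * (ε / 3) ^ δ) ≤ C * r ^ δ := by
  have hd : (T : Set X).PairwiseDisjoint fun t => Metric.closedBall t (ε / 3) := by
    intro a ha b hb hab
    exact Metric.closedBall_disjoint_closedBall (by have := hsep ha hb hab; linarith)
  have h1 : ∑ t ∈ T, μ (Metric.closedBall t (ε / 3)) ≤ μ (Metric.closedBall x r) := by
    rw [← measure_biUnion_finset hd fun _ _ => Metric.isClosed_closedBall.measurableSet]
    apply measure_mono
    refine iUnion₂_subset fun t ht => Metric.closedBall_subset_closedBall' ?_
    have := hT ht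
    rw [Metric.mem_closedBall] at this
    linarith
  have h2 : ∑ t ∈ T, ENNReal.ofReal (1 / C * (ε / 3) ^ δ) ≤
      ∑ t ∈ T, μ (Metric.closedBall t (ε / 3)) :=
    Finset.sum_le_sum fun t _ => (h t (ε / 3) (by positivity) (by linarith)).1
  have h3 := (h2.trans h1).trans (h x r hr hr₀).2
  rw [Finset.sum_const, nsmul_eq_mul, ← ENNReal.ofReal_natCast,
    ← ENNReal.ofReal_mul (by positivity)] at h3
  exact (ENNReal.ofReal_le_ofReal_iff (by positivity)).1 h3

theorem AhlforsBounds.exists_net (h : AhlforsBounds μ δ C r₀) (hC : 0 < C)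
    (x : X) {r ε : ℝ} (hr : 0 < r) (hr₀ : r ≤ r₀) (hε : 0 < ε) (hεr : ε ≤ r) {s : Set X}
    (hs : s ⊆ Metric.closedBall x (r - ε / 3)) :
    ∃ T : Finset X, ↑T ⊆ s ∧ (T : Set X).Pairwise (fun x y => ε ≤ dist x y) ∧
      s ⊆ ⋃ t ∈ T, Metric.closedBall t ε := by
  refine exists_maximal_separated_finset s hε ⌊C * r ^ δ / (1 / C * (ε / 3) ^ δ)⌋₊ ?_
  intro T hT hsep
  apply Nat.le_floor
  rw [le_div_iff₀ (by positivity)]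
  exact h.card_le hC x hr hr₀ hε hεr T (hT.trans hs) hsep

/-- Many separated points well inside a ball. -/
theorem AhlforsBounds.exists_separated (h : AhlforsBounds μ δ C r₀) (hC : 0 < C)
    (x : X) {r β : ℝ} (hr : 0 < r) (hr₀ : r ≤ r₀) (hβ : 0 < β) (hβ' : β ≤ 1 / 10) :
    ∃ T : Finset X, ↑T ⊆ Metric.closedBall x (r / 2) ∧
      (T : Set X).Pairwise (fun x y => 5 * (β * r) ≤ dist x y) ∧
      (C ^ 2 * 10 ^ δ)⁻¹ * β ^ (-δ) ≤ T.card := by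
  have hβr : β * r ≤ 1 / 10 * r := mul_le_mul_of_nonneg_right hβ' hr.le
  have hβr0 : 0 < β * r := by positivity
  -- A maximal separated set is a net, so comparing measures bounds its size from below. The half
  -- radius leaves room for balls of radius `β * r`.
  obtain ⟨T, h1, h2, h3⟩ := h.exists_net hC x (ε := 5 * (β * r)) (s := Metric.closedBall x (r / 2))
    hr hr₀ (by positivity) (by linarith) (Metric.closedBall_subset_closedBall (by linarith))
  refine ⟨T, h1, h2, ?_⟩
  have h4 := h.le_card_of_cover hC x (r := r / 2) (by positivity) (by linarith) (by positivity)
    (by linarith) T h3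
  have h5 : 5 * (β * r) = (10 * β) * (r / 2) := by ring
  rw [h5, Real.mul_rpow (by positivity) (by positivity),
    Real.mul_rpow (by positivity) (by positivity)] at h4
  have h6 : 0 < (r / 2) ^ δ := by positivity
  have h7 : 0 < β ^ δ := by positivity
  have h8 : (0 : ℝ) < 10 ^ δ := by positivity
  have h9 : 1 / C ≤ T.card * (C * (10 ^ δ * β ^ δ)) := by
    refine le_of_mul_le_mul_right ?_ h6
    linarith
  rw [div_le_iff₀ hC] at h9
  rw [Real.rpow_neg hβ.le, ← mul_inv, inv_le_iff_one_le_mul₀ (by positivity)]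
  linarith

end Ahlfors

/-! ### The potential of a ball -/

section Potential

variable {X : Type*} [MetricSpace X]

/-- The total weight of the balls that meet `B`. -/
noncomputable def ballPotential (w : CBall X → ℝ≥0∞) (B : CBall X) : ℝ≥0∞ :=
  ∑' D, {D : CBall X | (D.carrier ∩ B.carrier).Nonempty}.indicator w D

theorem le_ballPotential (w : CBall X → ℝ≥0∞) {B D : CBall X}
    (h : (D.carrier ∩ B.carrier).Nonempty) : w D ≤ ballPotential w B := by
  refine le_trans ?_ (ENNReal.le_tsum D)
  rw [indicator_of_mem (by exact h)]

/-- If the weight is carried by balls of radius at most `ρ`, then balls of radius `ρ` in `B` with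
`5 * ρ`-separated centres do not share any of the potential of `B`. -/
theorem sum_ballPotential_le (w : CBall X → ℝ≥0∞) (B : CBall X) {ρ : ℝ} (hρ : 0 < ρ)
    (hw : ∀ D, w D ≠ 0 → (D.carrier ∩ B.carrier).Nonempty → D.radius ≤ ρ) (T : Finset X)
    (hT : ∀ x ∈ T, (⟨x, ρ, hρ⟩ : CBall X).carrier ⊆ B.carrier)
    (hsep : (T : Set X).Pairwise fun x y => 5 * ρ ≤ dist x y) :
    ∑ x ∈ T, ballPotential w ⟨x, ρ, hρ⟩ ≤ ballPotential w B := by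
  unfold ballPotential
  rw [← Summable.tsum_finsetSum fun _ _ => ENNReal.summable]
  refine ENNReal.tsum_le_tsum fun D => ?_
  by_cases hD : ∃ x ∈ T, (D.carrier ∩ (⟨x, ρ, hρ⟩ : CBall X).carrier).Nonempty
  · obtain ⟨x, hx, hDx⟩ := hD
    have hDB : (D.carrier ∩ B.carrier).Nonempty := hDx.mono (inter_subset_inter_right _ (hT x hx))
    rw [indicator_of_mem (show D ∈ {D : CBall X | (D.carrier ∩ B.carrier).Nonempty} from hDB)]
    by_cases h0 : w D = 0
    · refine le_of_eq_of_le (Finset.sum_eq_zero fun y _ => ?_) zero_le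
      simp [h0]
    · have hr := hw D h0 hDB
      rw [Finset.sum_eq_single_of_mem x hx]
      · exact indicator_le_self _ _ _
      · intro y hy hyx
        refine indicator_of_notMem (fun hDy => ?_) _
        obtain ⟨p, hp1, hp2⟩ := hDx
        obtain ⟨q, hq1, hq2⟩ := (show (D.carrier ∩ (⟨y, ρ, hρ⟩ : CBall X).carrier).Nonempty from hDy)
        simp only [CBall.carrier, Metric.mem_closedBall] at hp1 hp2 hq1 hq2
        -- A ball of radius at most `ρ` meeting both balls would put their centres within `4 * ρ` of
        -- each other.
        have h1 := hsep hy hx hyx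
        have h2 := dist_triangle4 y q D.center x
        have h3 := dist_triangle D.center p x
        rw [dist_comm y q] at h2
        rw [dist_comm D.center p] at h3
        linarith
  · refine le_of_eq_of_le (Finset.sum_eq_zero fun y hy => ?_) zero_le
    exact indicator_of_notMem
      (s := {D : CBall X | (D.carrier ∩ CBall.carrier ⟨y, ρ, hρ⟩).Nonempty})
      (fun hDy => hD ⟨y, hy, hDy⟩) _

variable [MeasurableSpace X] [BorelSpace X] {μ : Measure X} {δ C r₀ : ℝ}

/-- Inside `A ⊆ B` there are `M` separated balls of small potential. -/
theorem AhlforsBounds.exists_children (h : AhlforsBounds μ δ C r₀) (hC : 0 < C) {A B : CBall X}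
    (hAB : A.Inside B) (hA : A.radius ≤ r₀) {β : ℝ} (hβ : 0 < β) (hβ' : β ≤ 1 / 10)
    (w : CBall X → ℝ≥0∞)
    (hw : ∀ D, w D ≠ 0 → (D.carrier ∩ B.carrier).Nonempty → D.radius ≤ β * A.radius)
    {W t : ℝ} (ht : 0 < t) (hW : ballPotential w B ≤ ENNReal.ofReal W) (hW0 : 0 ≤ W) {M : ℕ}
    (hM : M + W / t ≤ (C ^ 2 * 10 ^ δ)⁻¹ * β ^ (-δ)) :
    ∃ ch : Fin M → CBall X, (∀ j, (ch j).Inside A ∧ (ch j).radius = β * A.radius) ∧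
      (∀ j k, j ≠ k → 5 * (β * A.radius) ≤ dist (ch j).center (ch k).center) ∧
      ∀ j, ballPotential w (ch j) ≤ ENNReal.ofReal t := by
  classical
  have hρ : 0 < β * A.radius := mul_pos hβ A.radius_pos
  have hβA : β * A.radius ≤ 1 / 10 * A.radius := mul_le_mul_of_nonneg_right hβ' A.radius_pos.le
  obtain ⟨T, hT1, hT2, hT3⟩ := h.exists_separated hC A.center A.radius_pos hA hβ hβ'
  have hin : ∀ x ∈ T, (⟨x, β * A.radius, hρ⟩ : CBall X).Inside A := by
    intro x hx
    have := hT1 hx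
    rw [Metric.mem_closedBall] at this
    have := A.radius_pos
    simp only [CBall.Inside]
    linarith
  have hsum := sum_ballPotential_le w B hρ hw T
    (fun x hx => (hin x hx).carrier_subset.trans hAB.carrier_subset) hT2
  let good := T.filter fun x => ballPotential w ⟨x, β * A.radius, hρ⟩ ≤ ENNReal.ofReal t
  let bad := T.filter fun x => ¬ ballPotential w ⟨x, β * A.radius, hρ⟩ ≤ ENNReal.ofReal t
  have hcard : good.card + bad.card = T.card := Finset.card_filter_add_card_filter_not _
  -- Markov's inequality: the potentials of the candidates add up to at most `W`, and each bad one
  -- exceeds `t`.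
  have hbad : (bad.card : ℝ) * t ≤ W := by
    have h1 : ∑ x ∈ bad, ENNReal.ofReal t ≤ ∑ x ∈ bad, ballPotential w ⟨x, β * A.radius, hρ⟩ :=
      Finset.sum_le_sum fun x hx => (not_le.1 (Finset.mem_filter.1 hx).2).le
    have h2 := ((h1.trans (Finset.sum_le_sum_of_subset (Finset.filter_subset _ _))).trans
      hsum).trans hW
    rw [Finset.sum_const, nsmul_eq_mul, ← ENNReal.ofReal_natCast,
      ← ENNReal.ofReal_mul (by positivity)] at h2
    exact (ENNReal.ofReal_le_ofReal_iff hW0).1 h2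
  have hgood : M ≤ good.card := by
    have h1 : (bad.card : ℝ) ≤ W / t := by rwa [le_div_iff₀ ht]
    have h2 : (good.card : ℝ) + bad.card = T.card := by exact_mod_cast hcard
    have h3 : (M : ℝ) ≤ good.card := by linarith
    exact_mod_cast h3
  let e : Fin M → good := fun j => good.equivFin.symm (Fin.castLE hgood j)
  have he : Function.Injective e := good.equivFin.symm.injective.comp (Fin.castLE_injective hgood)
  have heT : ∀ j, (e j : X) ∈ T := fun j => (Finset.mem_filter.1 (e j).2).1
  refine ⟨fun j => ⟨e j, β * A.radius, hρ⟩, fun j => ⟨hin _ (heT j), rfl⟩, fun j k hjk => ?_,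
    fun j => (Finset.mem_filter.1 (e j).2).2⟩
  exact hT2 (heT j) (heT k) fun h => hjk (he (Subtype.ext h))

end Potential

/-! ### Bookkeeping of the balls deleted along a play. -/

section PlayWeight

variable {X : Type*}

/-- The weight of the balls that the strategy `σ` has chosen in the first `n` turns of the play
`h`. -/
noncomputable def playWeight (σ : (n : ℕ) → (Fin (n + 1) → CBall X) → Set (CBall X)) (s : ℝ)
    (h : ℕ → CBall X) (n : ℕ) (D : CBall X) : ℝ≥0∞ :=
  ∑ i ∈ Finset.range n,
    (σ i fun j => h j).indicator (fun D => ENNReal.ofReal (D.radius ^ s)) D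

variable {σ : (n : ℕ) → (Fin (n + 1) → CBall X) → Set (CBall X)} {s : ℝ}

/-- The replies of the first `n` turns see only `h 0, …, h (n - 1)`, so extending a play leaves the
earlier weights intact. -/
theorem playWeight_congr {h h' : ℕ → CBall X} {n : ℕ} (hh : ∀ i < n, h i = h' i) :
    playWeight σ s h n = playWeight σ s h' n := by
  funext D
  refine Finset.sum_congr rfl fun i hi => ?_
  have : (fun j : Fin (i + 1) => h j) = fun j : Fin (i + 1) => h' j := by
    funext j
    have := Finset.mem_range.1 hi
    exact hh j (by omega)
  rw [this]

theorem le_playWeight {h : ℕ → CBall X} {i n : ℕ} (hi : i < n) {D : CBall X}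
    (hD : D ∈ σ i fun j => h j) : ENNReal.ofReal (D.radius ^ s) ≤ playWeight σ s h n D := by
  refine le_of_eq_of_le ?_ (Finset.single_le_sum (fun _ _ => zero_le) (Finset.mem_range.2 hi))
  rw [indicator_of_mem hD]

theorem exists_mem_of_playWeight_ne_zero {h : ℕ → CBall X} {n : ℕ} {D : CBall X}
    (hD : playWeight σ s h n D ≠ 0) : ∃ i < n, D ∈ σ i fun j => h j := by
  obtain ⟨i, hi, h1⟩ := Finset.exists_ne_zero_of_sum_ne_zero hD
  exact ⟨i, Finset.mem_range.1 hi, mem_of_indicator_ne_zero h1⟩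

theorem radius_le_of_rpow_le (hs : 0 < s) {t : ℝ} (ht : 0 ≤ t) {D : CBall X}
    (h : ENNReal.ofReal (D.radius ^ s) ≤ ENNReal.ofReal (t ^ s)) : D.radius ≤ t := by
  rw [ENNReal.ofReal_le_ofReal_iff (by positivity)] at h
  exact (Real.rpow_le_rpow_iff D.radius_pos.le ht hs).1 h

theorem ballPotential_playWeight_succ_le [MetricSpace X] (h : ℕ → CBall X) (n : ℕ) (B : CBall X) :
    ballPotential (playWeight σ s h (n + 1)) B ≤ ballPotential (playWeight σ s h n) B +
      ∑' A : σ n fun j => h j, ENNReal.ofReal ((A : CBall X).radius ^ s) := by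
  rw [tsum_subtype (σ n fun j => h j) fun A => ENNReal.ofReal (A.radius ^ s)]
  unfold ballPotential
  rw [← ENNReal.tsum_add]
  refine ENNReal.tsum_le_tsum fun D => ?_
  by_cases hD : (D.carrier ∩ B.carrier).Nonempty
  · rw [indicator_of_mem (by exact hD), indicator_of_mem (by exact hD), playWeight,
      Finset.sum_range_succ]
    rfl
  · rw [indicator_of_notMem (by exact hD)]
    exact zero_le

end PlayWeight

/-! ### Playing the weak game and the potential game simultaneously -/

theorem IsSchmidtWinning.isWeakSchmidtWinning {X : Type*} [MetricSpace X] {α β : ℝ} {S : Set X}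
    (h : IsSchmidtWinning α β S) : IsWeakSchmidtWinning α β S := by
  obtain ⟨σ, h1, h2⟩ := h
  exact ⟨σ, fun n h => ⟨(h1 n h).1, (h1 n h).2.ge⟩, h2⟩

theorem IsWinning.isWeakWinning {X : Type*} [MetricSpace X] {S : Set X} (h : IsWinning S) :
    IsWeakWinning S := by
  obtain ⟨α, h0, h1, h⟩ := h
  exact ⟨α, h0, h1, fun β hβ hβ' => (h β hβ hβ').isWeakSchmidtWinning⟩

namespace CBall

variable {X : Type*} [MetricSpace X]

theorem Inside.radius_le {A B : CBall X} (h : A.Inside B) : A.radius ≤ B.radius := by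
  have := dist_nonneg (x := A.center) (y := B.center)
  unfold Inside at h
  linarith

theorem Inside.trans {A B D : CBall X} (h : A.Inside B) (h' : B.Inside D) : A.Inside D := by
  have := dist_triangle A.center B.center D.center
  unfold Inside at *
  linarith

theorem center_mem (B : CBall X) : B.center ∈ B.carrier :=
  Metric.mem_closedBall_self B.radius_pos.le

theorem nonempty_iInter_carrier [CompleteSpace X] {B : ℕ → CBall X}
    (hB : ∀ n, (B (n + 1)).Inside (B n)) (h0 : Tendsto (fun n => (B n).radius) atTop (𝓝 0)) :
    (⋂ n, (B n).carrier).Nonempty := by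
  have hanti : Antitone fun n => (B n).carrier :=
    antitone_nat_of_succ_le fun n => (hB n).carrier_subset
  refine Metric.nonempty_iInter_of_nonempty_biInter (fun n => Metric.isClosed_closedBall)
    (fun n => Metric.isBounded_closedBall) (fun N => ⟨(B N).center, ?_⟩) ?_
  · simp only [mem_iInter]
    exact fun n hn => hanti hn (B N).center_mem
  · refine squeeze_zero (fun n => Metric.diam_nonneg)
      (fun n => Metric.diam_closedBall (B n).radius_pos.le) ?_
    simpa using h0.const_mul 2

end CBall

/-- The play in which Bob answers the position `h 0, …, h n` by the ball `ch n h (a n)`; only the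
first `n + 1` terms of `play ch B₀ a n` matter. -/
noncomputable def play {X : Type*} {M : ℕ} (ch : ℕ → (ℕ → CBall X) → Fin M → CBall X)
    (B₀ : CBall X) (a : ℕ → Fin M) : ℕ → ℕ → CBall X
  | 0 => fun _ => B₀
  | n + 1 => Function.update (play ch B₀ a n) (n + 1) (ch n (play ch B₀ a n) (a n))

section Play

variable {X : Type*} {M : ℕ} (ch : ℕ → (ℕ → CBall X) → Fin M → CBall X) (B₀ : CBall X)

theorem play_apply_of_le (a : ℕ → Fin M) {n m j : ℕ} (hj : j ≤ n) (hn : n ≤ m) :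
    play ch B₀ a m j = play ch B₀ a n j := by
  induction m, hn using Nat.le_induction with
  | base => rfl
  | succ m hm ih => rw [play, Function.update_of_ne (by omega), ih]

theorem play_congr {a b : ℕ → Fin M} {n : ℕ} (h : ∀ i < n, a i = b i) :
    play ch B₀ a n = play ch B₀ b n := by
  induction n with
  | zero => rfl
  | succ n ih => rw [play, play, ih fun i hi => h i (by omega), h n (by omega)]

end Play

/-! ### The tree of plays against both strategies. -/

section Game

variable {X : Type*} [MetricSpace X] [MeasurableSpace X] [BorelSpace X] {μ : Measure X}
  {δ C r₀ : ℝ}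

/-- The inductive step: the bound `hpot` passes to `M` children. The term `2 * (α * β) ^ (-s)` in
`hM` counts the candidates that may be lost. -/
theorem AhlforsBounds.exists_children_of_strategies (h : AhlforsBounds μ δ C r₀) (hC : 0 < C)
    {α β s : ℝ} (hα : 0 < α) (hβ : 0 < β) (hβ' : β ≤ 1 / 10) (hs : 0 < s) {M : ℕ}
    (hM : M + 2 * (α * β) ^ (-s) ≤ (C ^ 2 * 10 ^ δ)⁻¹ * β ^ (-δ))
    {σ : (n : ℕ) → (Fin (n + 1) → CBall X) → Set (CBall X)}
    (hσ : ∀ n h, ∑' A : σ n h, ENNReal.ofReal ((A : CBall X).radius ^ s) ≤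
        ENNReal.ofReal ((α * β * (h (Fin.last n)).radius) ^ s))
    {n : ℕ} {p : ℕ → CBall X} (hp : (p n).radius ≤ r₀)
    (hpot : ballPotential (playWeight σ s p n) (p n) ≤
      ENNReal.ofReal ((α * β * (p n).radius) ^ s))
    {A : CBall X} (hA : A.Inside (p n)) (hA' : α * (p n).radius ≤ A.radius) :
    ∃ ch : Fin M → CBall X, (∀ j, (ch j).Inside A ∧ (ch j).radius = β * A.radius) ∧
      (∀ j k, j ≠ k → 5 * (β * A.radius) ≤ dist (ch j).center (ch k).center) ∧
      ∀ j, ballPotential (playWeight σ s p (n + 1)) (ch j) ≤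
        ENNReal.ofReal ((α * β * (ch j).radius) ^ s) := by
  have hr := (p n).radius_pos
  have hγ : 0 < α * β := mul_pos hα hβ
  have hAβ : α * β * (p n).radius ≤ β * A.radius := by nlinarith
  have hnew := hσ n fun j => p j
  simp only [Fin.val_last] at hnew
  have hW : ballPotential (playWeight σ s p (n + 1)) (p n) ≤
      ENNReal.ofReal (2 * (α * β * (p n).radius) ^ s) := by
    refine (ballPotential_playWeight_succ_le p n (p n)).trans ((add_le_add hpot hnew).trans ?_)
    rw [← ENNReal.ofReal_add (by positivity) (by positivity), two_mul]
  have hw : ∀ D, playWeight σ s p (n + 1) D ≠ 0 → (D.carrier ∩ (p n).carrier).Nonempty →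
      D.radius ≤ β * A.radius := by
    intro D hD hDB
    refine le_trans ?_ hAβ
    obtain ⟨i, hi, hDi⟩ := exists_mem_of_playWeight_ne_zero hD
    refine radius_le_of_rpow_le hs (by positivity) ?_
    -- An old ball is small because its own weight is part of the potential bounded by `hpot`; a new
    -- one because of Alice's budget.
    rcases Nat.lt_succ_iff_lt_or_eq.1 hi with hi | rfl
    · exact ((le_playWeight hi hDi).trans (le_ballPotential _ hDB)).trans hpot
    · exact (ENNReal.le_tsum (⟨D, hDi⟩ : σ i fun j => p j)).trans hnew
  have hM' : M + 2 * (α * β * (p n).radius) ^ s / (α * β * (α * β * (p n).radius)) ^ s ≤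
      (C ^ 2 * 10 ^ δ)⁻¹ * β ^ (-δ) := by
    convert hM using 2
    have h0 : 0 < (α * β * (p n).radius) ^ s := by positivity
    rw [Real.mul_rpow (y := α * β * (p n).radius) hγ.le (by positivity), Real.rpow_neg hγ.le,
      mul_div_mul_right _ _ h0.ne', div_eq_mul_inv]
  -- The threshold `t` is the invariant for the least possible child radius, `α * β * (p n).radius`;
  -- a larger ball of Alice only weakens the requirement.
  obtain ⟨ch, h1, h2, h3⟩ := h.exists_children hC (M := M) hA (hA.radius_le.trans hp) hβ hβ'
    (playWeight σ s p (n + 1)) hw (t := (α * β * (α * β * (p n).radius)) ^ s) (by positivity)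
    hW (by positivity) hM'
  refine ⟨ch, h1, h2, fun j => (h3 j).trans (ENNReal.ofReal_le_ofReal ?_)⟩
  rw [(h1 j).2]
  gcongr

theorem AhlforsBounds.le_dimH_inter [CompleteSpace X] (h : AhlforsBounds μ δ C r₀) (hC : 0 < C)
    {α β s : ℝ} (hα : 0 < α) (hα' : α < 1) (hβ : 0 < β) (hβ' : β ≤ 1 / 10) (hs : 0 < s) {M : ℕ}
    (hM1 : 1 < M) (hM2 : 1 ≤ (M : ℝ) * (α * β) ^ s)
    (hM : M + 2 * (α * β) ^ (-s) ≤ (C ^ 2 * 10 ^ δ)⁻¹ * β ^ (-δ)) {S E : Set X}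
    (hS : IsWeakSchmidtWinning α β S) (hE : IsPotentialWinningParam s (α * β) E)
    (B₀ : CBall X) (hB₀ : B₀.radius ≤ r₀) :
    ENNReal.ofReal s ≤ dimH (S ∩ E ∩ B₀.carrier) := by
  obtain ⟨τ, hτ1, hτ2⟩ := hS
  obtain ⟨σ, hσ1, hσ2⟩ := hE
  have hγ : 0 < α * β := mul_pos hα hβ
  have hstep : ∀ (n : ℕ) (p : ℕ → CBall X), ∃ ch : Fin M → CBall X, (p n).radius ≤ r₀ →
      ballPotential (playWeight σ s p n) (p n) ≤ ENNReal.ofReal ((α * β * (p n).radius) ^ s) →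
      (∀ j, (ch j).Inside (τ n fun i => p i) ∧
        (ch j).radius = β * (τ n fun i => p i).radius) ∧
      (∀ j k, j ≠ k →
        5 * (β * (τ n fun i => p i).radius) ≤ dist (ch j).center (ch k).center) ∧
      ∀ j, ballPotential (playWeight σ s p (n + 1)) (ch j) ≤
        ENNReal.ofReal ((α * β * (ch j).radius) ^ s) := by
    intro n p
    by_cases hp : (p n).radius ≤ r₀ ∧
      ballPotential (playWeight σ s p n) (p n) ≤ ENNReal.ofReal ((α * β * (p n).radius) ^ s)
    · obtain ⟨ch, hch⟩ := h.exists_children_of_strategies hC hα hβ hβ' hs hM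
        (fun n h => (hσ1 n h).2) hp.1 hp.2 (hτ1 n fun i => p i).1 (hτ1 n fun i => p i).2
      exact ⟨ch, fun _ _ => hch⟩
    -- An arbitrary value at positions violating the invariant, which the plays below never reach.
    · exact ⟨fun _ => B₀, fun h1 h2 => absurd ⟨h1, h2⟩ hp⟩
  choose ch hch using hstep
  let P : (ℕ → Fin M) → ℕ → CBall X := fun a n => play ch B₀ a n n
  have hP : ∀ a n, (fun i : Fin (n + 1) => play ch B₀ a n i) = fun i : Fin (n + 1) => P a i :=
    fun a n => funext fun i => play_apply_of_le ch B₀ a le_rfl (Nat.lt_succ_iff.1 i.2)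
  have hPsucc : ∀ a n, P a (n + 1) = ch n (play ch B₀ a n) (a n) := fun a n => by
    simp only [P, play, Function.update_self]
  have hτle : ∀ a n, α * (P a n).radius ≤ (τ n fun i => P a i).radius ∧
      (τ n fun i => P a i).Inside (P a n) := fun a n => by
    have := hτ1 n fun i => P a i
    simp only [Fin.val_last] at this
    exact ⟨this.2, this.1⟩
  have hinv : ∀ a n, (P a n).radius ≤ r₀ ∧
      ballPotential (playWeight σ s (play ch B₀ a n) n) (P a n) ≤
        ENNReal.ofReal ((α * β * (P a n).radius) ^ s) := by
    intro a n
    induction n with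
    | zero =>
      refine ⟨hB₀, le_of_eq_of_le ?_ zero_le⟩
      simp [ballPotential, playWeight]
    | succ n ih =>
      obtain ⟨h1, -, h3⟩ := hch n (play ch B₀ a n) ih.1 ih.2
      rw [hP] at h1
      refine ⟨?_, ?_⟩
      · rw [hPsucc]
        exact (((h1 _).1.trans (hτle a n).2).radius_le).trans ih.1
      · have := h3 (a n)
        rw [← hPsucc] at this
        rwa [playWeight_congr (h' := play ch B₀ a n)]
        intro i hi
        exact play_apply_of_le ch B₀ a (Nat.lt_succ_iff.1 hi) (Nat.le_succ n)
  have hmove : ∀ a n, (P a (n + 1)).Inside (τ n fun i => P a i) ∧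
      (P a (n + 1)).radius = β * (τ n fun i => P a i).radius := by
    intro a n
    have h1 := (hch n (play ch B₀ a n) (hinv a n).1 (hinv a n).2).1 (a n)
    rwa [hP, ← hPsucc] at h1
  have hins : ∀ a n, (P a (n + 1)).Inside (P a n) := fun a n =>
    (hmove a n).1.trans (hτle a n).2
  have hlow : ∀ a n, α * β * (P a n).radius ≤ (P a (n + 1)).radius := fun a n => by
    rw [(hmove a n).2]
    have := (hτle a n).1
    nlinarith
  have hup : ∀ a n, (P a n).radius ≤ B₀.radius * β ^ n := by
    intro a n
    induction n with
    | zero => simp [P, play]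
    | succ n ih =>
      rw [(hmove a n).2, pow_succ]
      have := (hτle a n).2.radius_le
      nlinarith
  have hlow' : ∀ a n, B₀.radius * (α * β) ^ n ≤ (P a n).radius := by
    intro a n
    induction n with
    | zero => simp [P, play]
    | succ n ih =>
      refine le_trans ?_ (hlow a n)
      rw [pow_succ]
      nlinarith
  have hlim : ∀ a, Tendsto (fun n => (P a n).radius) atTop (𝓝 0) := fun a => by
    refine squeeze_zero (fun n => (P a n).radius_pos.le) (hup a) ?_
    simpa using (tendsto_pow_atTop_nhds_zero_of_lt_one hβ.le (by linarith)).const_mul B₀.radius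
  choose g hg using fun a => CBall.nonempty_iInter_carrier (hins a) (hlim a)
  have hg' : ∀ a n, g a ∈ (P a n).carrier := fun a n => mem_iInter.1 (hg a) n
  have hgS : ∀ a, g a ∈ S := fun a => hτ2 (P a) (hmove a) (hg a)
  have hgE : ∀ a, g a ∈ E := by
    intro a
    rcases hσ2 (P a) fun n => ⟨hins a n, hlow a n⟩ with h1 | h1 | h1
    · exact absurd (hlim a) h1
    · obtain ⟨n, hn⟩ := mem_iUnion.1 (h1 (hg a))
      obtain ⟨D, hD, hgD⟩ := mem_iUnion₂.1 hn
      -- A deleted ball containing the limit meets every later ball of the play, so the invariant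
      -- bounds its radius at all later times.
      have hle : ∀ m, n + 1 ≤ m → D.radius ≤ α * β * (P a m).radius := by
        intro m hm
        refine radius_le_of_rpow_le hs (mul_pos hγ (P a m).radius_pos).le ?_
        refine ((le_playWeight (h := play ch B₀ a m) hm ?_).trans
          (le_ballPotential _ ⟨g a, hgD, hg' a m⟩)).trans (hinv a m).2
        have : (fun j : Fin (n + 1) => play ch B₀ a m j) = fun j : Fin (n + 1) => P a j :=
          funext fun i => play_apply_of_le ch B₀ a le_rfl (by omega)
        rwa [this]
      have h2 : Tendsto (fun m => α * β * (P a m).radius) atTop (𝓝 0) := by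
        simpa using (hlim a).const_mul (α * β)
      have h3 := ge_of_tendsto h2 (eventually_atTop.2 ⟨n + 1, hle⟩)
      exact absurd h3 (not_le.2 D.radius_pos)
    · exact h1 (hg a)
  have hdim : ENNReal.ofReal s ≤ dimH (range g) := by
    refine le_dimH_range_of_separated hM1 hs hγ (mul_pos B₀.radius_pos hγ) hM2 g ?_
    intro n a b hab hne
    have hpl := play_congr ch B₀ hab
    have h1 := (hch n (play ch B₀ a n) (hinv a n).1 (hinv a n).2).2.1 (a n) (b n) hne
    rw [← hPsucc, hpl, ← hPsucc, hP] at h1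
    have h2 := hg' a (n + 1)
    have h3 := hg' b (n + 1)
    have h4 := hmove b n
    have h5 : (P a (n + 1)).radius = β * (τ n fun i => P b i).radius := by
      rw [(hmove a n).2, ← hP a n, hpl, hP b n]
    simp only [CBall.carrier, Metric.mem_closedBall] at h2 h3
    -- The two children lie in the same ball of Alice, have equal radius `ρ` and centres at least `5
    -- * ρ` apart. The limits are therefore at least `3 * ρ` apart, and `ρ ≥ B₀.radius * (α * β) ^
    -- (n + 1)`.
    have h6 := dist_triangle4 (P a (n + 1)).center (g a) (g b) (P b (n + 1)).center
    rw [dist_comm (P a (n + 1)).center (g a)] at h6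
    have h7 := hlow' b (n + 1)
    have h8 := (P b (n + 1)).radius_pos
    rw [pow_succ] at h7
    have h9 : B₀.radius * (α * β) * (α * β) ^ n = B₀.radius * ((α * β) ^ n * (α * β)) := by ring
    rw [h9]
    linarith [h4.2]
  refine hdim.trans (dimH_mono ?_)
  rintro _ ⟨a, rfl⟩
  exact ⟨⟨hgS a, hgE a⟩, hg' a 0⟩

end Game

/-! ### Full dimension in Ahlfors regular spaces -/

/-- Since `s < δ`, the power `β ^ (-δ)` dominates. Of the factor `4`, two parts pay for the bad
candidates and two for rounding `(α * β) ^ (-s) > 1` up to the integer `M`. -/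
theorem exists_small_parameter {α s δ κ : ℝ} (hα : 0 < α) (hs : s < δ) (hκ : 0 < κ) :
    ∃ β : ℝ, 0 < β ∧ β ≤ 1 / 10 ∧ 4 * (α * β) ^ (-s) ≤ κ * β ^ (-δ) := by
  have hδs : 0 < δ - s := sub_pos.2 hs
  have hq : 0 < κ * α ^ s / 4 := by positivity
  refine ⟨min (1 / 10) ((κ * α ^ s / 4) ^ (δ - s)⁻¹), lt_min (by norm_num) (by positivity),
    min_le_left _ _, ?_⟩
  set β := min (1 / 10) ((κ * α ^ s / 4) ^ (δ - s)⁻¹)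
  have hβ : 0 < β := lt_min (by norm_num) (by positivity)
  have h1 : β ^ (δ - s) ≤ κ * α ^ s / 4 := by
    refine (Real.rpow_le_rpow hβ.le (min_le_right _ _) hδs.le).trans_eq ?_
    rw [← Real.rpow_mul hq.le, inv_mul_cancel₀ hδs.ne', Real.rpow_one]
  rw [Real.rpow_sub hβ, div_le_iff₀ (by positivity)] at h1
  rw [Real.mul_rpow hα.le hβ.le, Real.rpow_neg hα.le, Real.rpow_neg hβ.le, Real.rpow_neg hβ.le]
  have h2 : 0 < α ^ s := by positivity
  have h3 : 0 < β ^ s := by positivity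
  have h4 : 0 < β ^ δ := by positivity
  rw [← mul_inv, ← div_eq_mul_inv, ← div_eq_mul_inv, div_le_div_iff₀ (by positivity) h4]
  linarith

section Ahlfors

variable {X : Type*} [MetricSpace X] [MeasurableSpace X] [BorelSpace X] {δ : ℝ} {S E : Set X}

/-- The bound is local, in every ball, because density of `S ∩ E` is needed in the non-separable
case. -/
theorem IsAhlforsRegular.le_dimH_inter_carrier [CompleteSpace X] (hX : IsAhlforsRegular X δ)
    (hS : IsWeakWinning S) (hE : IsPotentialWinning δ E) (B₀ : CBall X) :
    ENNReal.ofReal δ ≤ dimH (S ∩ E ∩ B₀.carrier) := by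
  obtain ⟨-, μ, C, r₀, hC, hr₀, hμ⟩ := hX
  have hμ' : AhlforsBounds μ δ C r₀ := hμ
  obtain ⟨α, hα, hα', hS⟩ := hS
  obtain ⟨c₀, hc₀, hc₀δ, hE⟩ := hE
  by_contra! hlt
  obtain ⟨s, hs1, hs2⟩ := exists_between
    (max_lt hc₀δ ((ENNReal.lt_ofReal_iff_toReal_lt hlt.ne_top).1 hlt))
  have hcs : c₀ < s := (le_max_left _ _).trans_lt hs1
  have hs : 0 < s := hc₀.trans_lt hcs
  obtain ⟨β, hβ, hβ', h4⟩ := exists_small_parameter hα hs2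
    (show 0 < (C ^ 2 * 10 ^ δ)⁻¹ by positivity)
  have hγ : 0 < α * β := mul_pos hα hβ
  have hγ1 : 1 < (α * β) ^ (-s) :=
    Real.one_lt_rpow_of_pos_of_lt_one_of_neg hγ (by nlinarith) (by linarith)
  let B₁ : CBall X := ⟨B₀.center, min B₀.radius r₀, lt_min B₀.radius_pos hr₀⟩
  have h1 := hμ'.le_dimH_inter hC hα hα' hβ hβ' hs (M := ⌈(α * β) ^ (-s)⌉₊)
    (Nat.lt_ceil.2 (by simpa using hγ1)) ?_ ?_ (hS β hβ (by linarith))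
    (hE s (α * β) hcs hγ) B₁ (min_le_right _ _)
  · have h2 : dimH (S ∩ E ∩ B₁.carrier) ≤ dimH (S ∩ E ∩ B₀.carrier) :=
      dimH_mono (inter_subset_inter_right _ (Metric.closedBall_subset_closedBall (min_le_left _ _)))
    have h3 : ENNReal.ofReal (dimH (S ∩ E ∩ B₀.carrier)).toReal < ENNReal.ofReal s :=
      (ENNReal.ofReal_lt_ofReal_iff hs).2 ((le_max_right _ _).trans_lt hs1)
    rw [ENNReal.ofReal_toReal hlt.ne_top] at h3
    exact absurd (h1.trans h2) (not_le.2 h3)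
  · have h5 := mul_le_mul_of_nonneg_right (Nat.le_ceil ((α * β) ^ (-s)))
      (show 0 ≤ (α * β) ^ s by positivity)
    rwa [← Real.rpow_add hγ, neg_add_cancel, Real.rpow_zero] at h5
  · have := Nat.ceil_lt_add_one (show 0 ≤ (α * β) ^ (-s) by positivity)
    linarith

/-- Separability gives a countable cover by balls of radius `r₀ / 2`. Each has finite
`δ`-dimensional Hausdorff measure, since by packing an `ε`-net in it has `O(ε ^ (-δ))` points. -/
theorem IsAhlforsRegular.dimH_univ_le (hX : IsAhlforsRegular X δ)
    [TopologicalSpace.SeparableSpace X] : dimH (univ : Set X) ≤ ENNReal.ofReal δ := by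
  obtain ⟨hδ, μ, C, r₀, hC, hr₀, hμ⟩ := hX
  have hμ' : AhlforsBounds μ δ C r₀ := hμ
  obtain ⟨D, hD, hDd⟩ := TopologicalSpace.exists_countable_dense X
  have hcov : (univ : Set X) ⊆ ⋃ x ∈ D, Metric.closedBall x (r₀ / 2) := by
    intro y _
    obtain ⟨x, hx, hxD⟩ := Metric.dense_iff.1 hDd y (r₀ / 2) (by positivity)
    refine mem_iUnion₂.2 ⟨x, hxD, ?_⟩
    rw [Metric.mem_closedBall, dist_comm]
    exact (Metric.mem_ball.1 hx).le
  refine (dimH_mono hcov).trans ?_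
  rw [dimH_bUnion hD]
  refine iSup₂_le fun x _ => ?_
  borelize X
  have key : ∀ n : ℕ, ∃ T : Finset X,
      Metric.closedBall x (r₀ / 2) ⊆ ⋃ t : T, Metric.closedBall (t : X) (r₀ / (n + 1)) ∧
      (T.card : ℝ) * (2 * (r₀ / (n + 1))) ^ δ ≤ C * r₀ ^ δ * C * 6 ^ δ := by
    intro n
    have hn : (0 : ℝ) < n + 1 := by positivity
    have hn' : r₀ / (n + 1) ≤ r₀ := div_le_self hr₀.le (by linarith [n.cast_nonneg (α := ℝ)])
    have hsub : Metric.closedBall x (r₀ / 2) ⊆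
        Metric.closedBall x (r₀ - r₀ / (n + 1) / 3) :=
      Metric.closedBall_subset_closedBall (by linarith)
    obtain ⟨T, h1, h2, h3⟩ := hμ'.exists_net hC x hr₀ le_rfl (by positivity) hn' hsub
    refine ⟨T, by simpa [iUnion_subtype] using h3, ?_⟩
    have h4 := hμ'.card_le hC x hr₀ le_rfl (by positivity) hn' T (h1.trans hsub) h2
    have h5 : 2 * (r₀ / (n + 1)) = 6 * (r₀ / (n + 1) / 3) := by ring
    -- The `6` compares the diameter bound `2 * ε` of the covering balls with the packing radius `ε
    -- / 3`.
    rw [h5, Real.mul_rpow (by norm_num) (by positivity)]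
    have h6 : (T.card : ℝ) * (r₀ / (n + 1) / 3) ^ δ ≤ C * r₀ ^ δ * C := by
      rw [← div_le_iff₀ hC]
      refine le_of_eq_of_le ?_ h4
      ring
    have h7 : (0 : ℝ) < 6 ^ δ := by positivity
    nlinarith
  choose T hT1 hT2 using key
  have hlim : Tendsto (fun n : ℕ => ENNReal.ofReal (2 * (r₀ / (n + 1)))) atTop (𝓝 0) := by
    rw [← ENNReal.ofReal_zero]
    refine ENNReal.tendsto_ofReal ?_
    have := (tendsto_one_div_add_atTop_nhds_zero_nat (𝕜 := ℝ)).const_mul (2 * r₀)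
    rw [mul_zero] at this
    refine this.congr fun n => ?_
    ring
  have hdiam : ∀ n (t : T n), Metric.ediam (Metric.closedBall (t : X) (r₀ / (n + 1))) ≤
      ENNReal.ofReal (2 * (r₀ / (n + 1))) := by
    intro n t
    rw [← Metric.closedEBall_ofReal (by positivity), ENNReal.ofReal_mul (by norm_num)]
    simpa using Metric.ediam_closedEBall_le
  have h1 := Measure.hausdorffMeasure_le_liminf_sum δ (Metric.closedBall x (r₀ / 2)) _ hlim
    (fun n (t : T n) => Metric.closedBall (t : X) (r₀ / (n + 1)))
    (Eventually.of_forall hdiam) (Eventually.of_forall hT1)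
  have h2 : liminf (fun n => ∑ t : T n,
      Metric.ediam (Metric.closedBall (t : X) (r₀ / (n + 1))) ^ δ) atTop ≤
      ENNReal.ofReal (C * r₀ ^ δ * C * 6 ^ δ) := by
    refine liminf_le_of_le (by isBoundedDefault) fun b hb => ?_
    obtain ⟨n, hn⟩ := hb.exists
    refine hn.trans ?_
    refine (Finset.sum_le_sum fun t _ => ENNReal.rpow_le_rpow (hdiam n t) hδ.le).trans ?_
    rw [Finset.sum_const, nsmul_eq_mul, Finset.card_univ, Fintype.card_coe,
      ENNReal.ofReal_rpow_of_nonneg (by positivity) hδ.le, ← ENNReal.ofReal_natCast,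
      ← ENNReal.ofReal_mul (by positivity)]
    exact ENNReal.ofReal_le_ofReal (hT2 n)
  have h3 := (h1.trans h2).trans_lt ENNReal.ofReal_lt_top
  have h4 : Measure.hausdorffMeasure (δ.toNNReal : ℝ) (Metric.closedBall x (r₀ / 2)) ≠ ⊤ := by
    rw [Real.coe_toNNReal δ hδ.le]
    exact h3.ne
  exact dimH_le_of_hausdorffMeasure_ne_top h4

end Ahlfors

/-- Some Hausdorff measure of `s` vanishes. If `s` had no countable cover by sets of diameter at
most `ε`, the infimum defining that measure at scale `ε` would be empty, hence `⊤`. -/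
theorem isSeparable_of_dimH_ne_top {X : Type*} [MetricSpace X] {s : Set X}
    (h : dimH s ≠ ⊤) : TopologicalSpace.IsSeparable s := by
  obtain ⟨d, hd⟩ := ENNReal.lt_iff_exists_nnreal_btwn.1 h.lt_top
  borelize X
  have h0 := hausdorffMeasure_of_dimH_lt hd.1
  rw [Measure.hausdorffMeasure_apply] at h0
  have hcov : ∀ ε : ℝ≥0∞, 0 < ε → ∃ t : ℕ → Set X, s ⊆ ⋃ n, t n ∧ ∀ n, Metric.ediam (t n) ≤ ε := by
    intro ε hε
    by_contra! hno
    have h1 := (le_iSup₂ (α := ℝ≥0∞) ε hε).trans_eq h0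
    refine absurd h1 (not_le.2 (lt_of_lt_of_eq ENNReal.zero_lt_top (Eq.symm ?_)))
    simp only [iInf_eq_top]
    intro t ht1 ht2
    obtain ⟨n, hn⟩ := hno t ht1
    exact absurd (ht2 n) (not_le.2 hn)
  have hdense : ∀ ε : ℝ≥0∞, 0 < ε → ∃ t : Set X, t.Countable ∧
      s ⊆ ⋃ x ∈ t, Metric.closedEBall x ε := by
    intro ε hε
    obtain ⟨t, ht1, ht2⟩ := hcov ε hε
    choose x hx using fun n : {n // (t n).Nonempty} => n.2
    refine ⟨range x, countable_range x, fun y hy => ?_⟩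
    obtain ⟨n, hn⟩ := mem_iUnion.1 (ht1 hy)
    exact mem_iUnion₂.2 ⟨x ⟨n, y, hn⟩, mem_range_self _,
      (Metric.edist_le_ediam_of_mem hn (hx ⟨n, y, hn⟩)).trans (ht2 n)⟩
  obtain ⟨t, -, ht, hst⟩ := EMetric.subset_countable_closure_of_almost_dense_set s hdense
  exact ⟨t, ht, hst⟩

theorem IsAhlforsRegular.dimH_inter {X : Type*} [MetricSpace X] [CompleteSpace X]
    [MeasurableSpace X] [BorelSpace X] {δ : ℝ} {S E : Set X} (hX : IsAhlforsRegular X δ)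
    [Nonempty X] (hS : IsWeakWinning S) (hE : IsPotentialWinning δ E) :
    dimH (S ∩ E) = dimH (univ : Set X) ∧
      (TopologicalSpace.SeparableSpace X → dimH (S ∩ E) = ENNReal.ofReal δ) := by
  have hδ : 0 < δ := hX.1
  have hge : ENNReal.ofReal δ ≤ dimH (S ∩ E) :=
    (hX.le_dimH_inter_carrier hS hE ⟨Classical.arbitrary X, 1, one_pos⟩).trans
      (dimH_mono inter_subset_left)
  have hsep : TopologicalSpace.SeparableSpace X → dimH (S ∩ E) = dimH (univ : Set X) ∧
      dimH (S ∩ E) = ENNReal.ofReal δ := by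
    intro _
    have h1 := hX.dimH_univ_le
    have h2 := dimH_mono (subset_univ (S ∩ E))
    exact ⟨le_antisymm h2 (h1.trans hge), le_antisymm (h2.trans h1) hge⟩
  refine ⟨?_, fun h => (hsep h).2⟩
  by_cases hX' : TopologicalSpace.SeparableSpace X
  · exact (hsep hX').1
  by_cases htop : dimH (S ∩ E) = ⊤
  · exact le_antisymm (dimH_mono (subset_univ _)) (htop ▸ le_top)
  -- The local lower bound is positive, so `S ∩ E` meets every ball; being separable, it would make
  -- `X` separable.
  have hdense : Dense (S ∩ E) := by
    refine Metric.dense_iff.2 fun x r hr => ?_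
    have h1 := hX.le_dimH_inter_carrier hS hE ⟨x, r / 2, by positivity⟩
    have hne : (S ∩ E ∩ Metric.closedBall x (r / 2)).Nonempty := by
      by_contra h
      rw [not_nonempty_iff_eq_empty] at h
      rw [CBall.carrier, h, dimH_empty] at h1
      exact absurd h1 (by simpa using hδ)
    refine hne.mono ?_
    rw [inter_comm]
    exact inter_subset_inter_left _ (Metric.closedBall_subset_ball (by linarith))
  have h2 := (isSeparable_of_dimH_ne_top htop).closure
  rw [hdense.closure_eq] at h2
  exact absurd (TopologicalSpace.isSeparable_univ_iff.1 h2) hX'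

/-! ### Boxes -/

theorem exists_abs_sub_odd_mul_le {y q : ℝ} {u : ℕ} (hu : 0 < u) (hq : 0 < q) (hy : 0 ≤ y)
    (hy' : y ≤ 2 * u * q) : ∃ k : Fin u, |y - (2 * ((k : ℕ) : ℝ) + 1) * q| ≤ q := by
  have hfl := Nat.floor_le (show 0 ≤ y / (2 * q) by positivity)
  have hlt := Nat.lt_floor_add_one (y / (2 * q))
  rw [le_div_iff₀ (by positivity)] at hfl
  rw [div_lt_iff₀ (by positivity)] at hlt
  by_cases h : ⌊y / (2 * q)⌋₊ < u
  · refine ⟨⟨_, h⟩, abs_le.2 ⟨?_, ?_⟩⟩ <;> dsimp only <;> linarith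
  · have h1 : (u : ℝ) ≤ ⌊y / (2 * q)⌋₊ := by exact_mod_cast not_lt.1 h
    have h2 : (u : ℝ) * (2 * q) ≤ ⌊y / (2 * q)⌋₊ * (2 * q) :=
      mul_le_mul_of_nonneg_right h1 (by positivity)
    -- Only the right endpoint `y = 2 * u * q` gets here; it belongs to the last interval.
    refine ⟨⟨u - 1, by omega⟩, ?_⟩
    have h3 : ((u - 1 : ℕ) : ℝ) = u - 1 := by
      rw [Nat.cast_sub (by omega), Nat.cast_one]
    dsimp only
    rw [h3, abs_le]
    constructor <;> linarith

theorem exists_mem_boxSplit {N : ℕ} (B : CBall (Fin N → ℝ)) {u : ℕ} (hu : 0 < u)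
    {x : Fin N → ℝ} (hx : x ∈ B.carrier) : ∃ A ∈ boxSplit B u, x ∈ A.carrier := by
  have hu' : (0 : ℝ) < u := by exact_mod_cast hu
  have hq : 0 < B.radius / u := div_pos B.radius_pos hu'
  have hqu : 2 * u * (B.radius / u) = 2 * B.radius := by field_simp
  have hx' : ∀ i, |x i - B.center i| ≤ B.radius := fun i => by
    rw [← Real.dist_eq]
    exact (dist_le_pi_dist _ _ i).trans hx
  have h : ∀ i, ∃ k : Fin u,
      |x i - B.center i + B.radius - (2 * ((k : ℕ) : ℝ) + 1) * (B.radius / u)| ≤ B.radius / u :=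
    fun i => exists_abs_sub_odd_mul_le hu hq (by linarith [(abs_le.1 (hx' i)).1])
      (by linarith [(abs_le.1 (hx' i)).2])
  choose k hk using h
  refine ⟨subBox B u hu k, ⟨hu, k, rfl⟩, (dist_pi_le_iff hq.le).2 fun i => ?_⟩
  rw [Real.dist_eq]
  refine le_of_eq_of_le ?_ (hk i)
  simp only [subBox]
  ring_nf

/-- The centres of two such boxes differ by at most four box radii in each coordinate, so their
indices differ by at most `2` and are determined by their residues mod `3`. -/
theorem encard_boxSplit_inter_le {N : ℕ} (B : CBall (Fin N → ℝ)) {u : ℕ} (hu : 0 < u)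
    (y : Fin N → ℝ) :
    {A ∈ boxSplit B u | (A.carrier ∩ Metric.closedBall y (B.radius / u)).Nonempty}.encard ≤
      (3 ^ N : ℕ) := by
  have hu' : (0 : ℝ) < u := by exact_mod_cast hu
  have hq : 0 < B.radius / u := div_pos B.radius_pos hu'
  let s : Set (Fin N → Fin u) :=
    {k | ((subBox B u hu k).carrier ∩ Metric.closedBall y (B.radius / u)).Nonempty}
  have hs : {A ∈ boxSplit B u | (A.carrier ∩ Metric.closedBall y (B.radius / u)).Nonempty} ⊆
      subBox B u hu '' s := by
    rintro _ ⟨⟨_, k, rfl⟩, hk⟩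
    exact ⟨k, hk, rfl⟩
  refine (encard_le_encard hs).trans ((encard_image_le _ _).trans ?_)
  have hdist : ∀ k ∈ s, ∀ i,
      |y i - (B.center i - B.radius + (2 * ((k i : ℕ) : ℝ) + 1) * (B.radius / u))| ≤
        2 * (B.radius / u) := by
    rintro k ⟨p, hp1, hp2⟩ i
    have h1 := (dist_le_pi_dist _ _ i).trans (Metric.mem_closedBall.1 hp1)
    have h2 := (dist_le_pi_dist _ _ i).trans (Metric.mem_closedBall.1 hp2)
    rw [Real.dist_eq, abs_le] at h1 h2
    simp only [subBox] at h1
    rw [abs_le]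
    constructor <;> linarith [h1.1, h1.2, h2.1, h2.2]
  have hinj : InjOn (fun (k : Fin N → Fin u) i => ((k i : ℕ) : ZMod 3)) s := by
    intro k hk l hl hkl
    funext i
    have h0 := congrFun hkl i
    simp only [ZMod.natCast_eq_natCast_iff] at h0
    have h1 := abs_le.1 (hdist k hk i)
    have h2 := abs_le.1 (hdist l hl i)
    have h3 : ((k i : ℕ) : ℝ) * (B.radius / u) ≤ (((l i : ℕ) : ℝ) + 2) * (B.radius / u) := by
      linarith [h1.1, h2.2]
    have h4 : ((l i : ℕ) : ℝ) * (B.radius / u) ≤ (((k i : ℕ) : ℝ) + 2) * (B.radius / u) := by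
      linarith [h1.2, h2.1]
    have h5 : (k i : ℕ) ≤ (l i : ℕ) + 2 := by exact_mod_cast le_of_mul_le_mul_right h3 hq
    have h6 : (l i : ℕ) ≤ (k i : ℕ) + 2 := by exact_mod_cast le_of_mul_le_mul_right h4 hq
    have h7 : (k i : ℕ) % 3 = (l i : ℕ) % 3 := h0
    apply Fin.ext
    omega
  refine (encard_le_encard_of_injOn (mapsTo_univ _ _) hinj).trans ?_
  rw [encard_univ, ENat.card_eq_coe_fintype_card]
  simp

/-! ### Cantor sets -/

/-- Places all survivors of one level in a single grid, where neighbours can be counted. -/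
theorem SplittingStructure.subset_split_pow {X : Type*} [MetricSpace X] (𝒮 : SplittingStructure X)
    {B₀ : CBall X} {R : ℕ} (hR : R ∈ 𝒮.U) (h1 : 𝒮.split B₀ 1 = {B₀}) {𝓑 : ℕ → Set (CBall X)}
    (h0 : 𝓑 0 = {B₀}) (hsucc : ∀ n, 𝓑 (n + 1) ⊆ 𝒮.splitAll (𝓑 n) R) (n : ℕ) :
    𝓑 n ⊆ 𝒮.split B₀ (R ^ n) := by
  have hone : 1 ∈ 𝒮.U := by
    have := 𝒮.div_mem R hR R hR dvd_rfl
    rwa [Nat.div_self (𝒮.U_pos R hR)] at this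
  have hpow : ∀ n, R ^ n ∈ 𝒮.U := fun n => by
    induction n with
    | zero => simpa using hone
    | succ n ih => rw [pow_succ]; exact 𝒮.mul_mem _ ih _ hR
  induction n with
  | zero => rw [pow_zero, h0, h1]
  | succ n ih =>
    rw [pow_succ, 𝒮.split_mul _ _ (hpow n) _ hR]
    exact (hsucc n).trans (biUnion_subset_biUnion_left ih)

theorem boxSplit_one {N : ℕ} (B : CBall (Fin N → ℝ)) : boxSplit B 1 = {B} := by
  rw [boxSplit_eq_range B 1 one_pos]
  have h : ∀ k, subBox B 1 one_pos k = B := fun k => by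
    apply CBall.ext
    · funext i
      simp [subBox]
    · simp [subBox]
  rw [funext h, range_const]

/-- A point of the initial box that is not in the Cantor set lies in one of the removed boxes. -/
theorem mem_removed_of_notMem_cantorSet {N : ℕ} {B₀ : CBall (Fin N → ℝ)} {R : ℕ} (hR : 0 < R)
    {𝓑 : ℕ → Set (CBall (Fin N → ℝ))} {𝓐 : ℕ → ℕ → Set (CBall (Fin N → ℝ))}
    (h0 : 𝓑 0 = {B₀})
    (h1 : ∀ n, 𝓑 (n + 1) = (standardSplitting N).splitAll (𝓑 n) R \ ⋃ m ≤ n, 𝓐 m n)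
    (h2 : ∀ m n, m ≤ n → 𝓐 m n ⊆ (standardSplitting N).splitAll (𝓑 m) (R ^ (n - m + 1)))
    {x : Fin N → ℝ} (hx : x ∈ B₀.carrier) (hxK : x ∉ ⋂ n, ⋃ B ∈ 𝓑 n, B.carrier) :
    ∃ m n, m ≤ n ∧ ∃ A ∈ 𝓐 m n, ∃ B ∈ 𝓑 m, A.Inside B ∧ x ∈ A.carrier := by
  by_contra hno
  refine hxK (mem_iInter.2 fun n => ?_)
  induction n with
  | zero => exact mem_iUnion₂.2 ⟨B₀, by rw [h0]; exact mem_singleton _, hx⟩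
  | succ n ih =>
    obtain ⟨B, hB, hxB⟩ := mem_iUnion₂.1 ih
    obtain ⟨A, hA, hxA⟩ := exists_mem_boxSplit B hR hxB
    refine mem_iUnion₂.2 ⟨A, ?_, hxA⟩
    rw [h1]
    refine ⟨mem_iUnion₂.2 ⟨B, hB, hA⟩, fun hA' => ?_⟩
    obtain ⟨m, hm, hAm⟩ := mem_iUnion₂.1 hA'
    obtain ⟨B', hB', hAB'⟩ := mem_iUnion₂.1 (h2 m n hm hAm)
    exact hno ⟨m, n, hm, A, hAm, B', hB',
      ((standardSplitting N).split_inside B' _ (Nat.pow_pos hR) A hAB').1, hxA⟩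

/-- The first radius not exceeding `t` works, because one step shrinks by a factor of at least `β`
and cannot jump over the window. -/
theorem exists_radius_mem_Icc {r : ℕ → ℝ} {β t : ℝ} (hβ : 0 < β)
    (hle : ∀ n, r (n + 1) ≤ r n) (hge : ∀ n, β * r n ≤ r (n + 1))
    (hlim : Tendsto r atTop (𝓝 0)) (ht : 0 < t) (ht' : t ≤ r 0) :
    ∃ n, β * t ≤ r n ∧ r n ≤ t := by
  have hex : ∃ n, r n ≤ t := ((hlim.eventually (gt_mem_nhds ht)).exists).imp fun _ h => h.le
  classical
  refine ⟨Nat.find hex, ?_, Nat.find_spec hex⟩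
  rcases hn : Nat.find hex with _ | n
  · have h1 : β * r 0 ≤ r 0 := (hge 0).trans (hle 0)
    exact (mul_le_mul_of_nonneg_left ht' hβ.le).trans h1
  · have h1 : t < r n := not_le.1 (Nat.find_min hex (by omega))
    exact (mul_le_mul_of_nonneg_left h1.le hβ.le).trans (hge n)

theorem tsum_radius_rpow_le {X : Type*} {s : Set (CBall X)} (hs : s.Finite) {b ρ c : ℝ}
    (hb : (s.ncard : ℝ) ≤ b) (hρ : 0 ≤ ρ) (h : ∀ A ∈ s, A.radius = ρ) :
    ∑' A : s, ENNReal.ofReal ((A : CBall X).radius ^ c) ≤ ENNReal.ofReal (b * ρ ^ c) := by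
  have h1 : ∀ A : s, ENNReal.ofReal ((A : CBall X).radius ^ c) = ENNReal.ofReal (ρ ^ c) :=
    fun A => by rw [h A A.2]
  have := hs.fintype
  rw [tsum_congr h1, tsum_fintype, Finset.sum_const, Finset.card_univ, nsmul_eq_mul,
    ← Nat.card_eq_fintype_card, Nat.card_coe_set_eq, ← ENNReal.ofReal_natCast,
    ← ENNReal.ofReal_mul (by positivity)]
  exact ENNReal.ofReal_le_ofReal (mul_le_mul_of_nonneg_right hb (by positivity))

/-- The choice of the number of pieces in a Cantor set that makes the removed boxes small. -/
theorem exists_large_parameter {β η D c : ℝ} (hβ : 0 < β) (hη : 0 < η) (R₀ : ℕ) :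
    ∃ R : ℕ, R₀ ≤ R ∧ 0 < R ∧ 1 < R * β ∧ (R : ℝ) ^ (-η) ≤ 1 / 2 ∧
      D * (2 * (R : ℝ) ^ (-η)) ≤ β ^ (2 * c) := by
  have h1 : Tendsto (fun R : ℕ => (R : ℝ) ^ (-η)) atTop (𝓝 0) :=
    (tendsto_rpow_neg_atTop hη).comp tendsto_natCast_atTop_atTop
  have h2 : Tendsto (fun R : ℕ => D * (2 * (R : ℝ) ^ (-η))) atTop (𝓝 0) := by
    simpa using (h1.const_mul 2).const_mul D
  have h3 : Tendsto (fun R : ℕ => (R : ℝ) * β) atTop atTop :=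
    tendsto_natCast_atTop_atTop.atTop_mul_const hβ
  obtain ⟨R, ⟨⟨⟨⟨ha, hb⟩, hc⟩, hd⟩, he⟩⟩ :=
    ((((eventually_ge_atTop R₀).and (eventually_gt_atTop 0)).and
      (h3.eventually_gt_atTop 1)).and (h1.eventually_le_const (show (0 : ℝ) < 1 / 2 by norm_num))).and
      (h2.eventually_le_const (Real.rpow_pos_of_pos hβ (2 * c))) |>.exists
  exact ⟨R, ha, hb, hc, hd, he⟩

/-! ### Cantor winning sets are potential winning -/

/-- The members of `𝓐` inside those members of `𝓑` that meet the set `Y`. -/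
def removedNear {X : Type*} [MetricSpace X] (𝓑 𝓐 : Set (CBall X)) (Y : Set X) : Set (CBall X) :=
  {A ∈ 𝓐 | ∃ B ∈ 𝓑, A.Inside B ∧ (B.carrier ∩ Y).Nonempty}

theorem removedNear_finite_and_ncard_le {N : ℕ} {B₀ : CBall (Fin N → ℝ)} {u : ℕ} (hu : 0 < u)
    {𝓑 𝓐 : Set (CBall (Fin N → ℝ))} (h𝓑 : 𝓑 ⊆ boxSplit B₀ u) {b : ℝ}
    (hb : ∀ B ∈ 𝓑, {A ∈ 𝓐 | A.Inside B}.Finite ∧ ({A ∈ 𝓐 | A.Inside B}.ncard : ℝ) ≤ b)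
    (hb0 : 0 ≤ b) (y : Fin N → ℝ) :
    (removedNear 𝓑 𝓐 (Metric.closedBall y (B₀.radius / u))).Finite ∧
      ((removedNear 𝓑 𝓐 (Metric.closedBall y (B₀.radius / u))).ncard : ℝ) ≤ 3 ^ N * b := by
  let F := {B ∈ 𝓑 | (B.carrier ∩ Metric.closedBall y (B₀.radius / u)).Nonempty}
  have hF : F.encard ≤ (3 ^ N : ℕ) :=
    (encard_le_encard (t := {A ∈ boxSplit B₀ u |
      (A.carrier ∩ Metric.closedBall y (B₀.radius / u)).Nonempty})
      fun B hB => ⟨h𝓑 hB.1, hB.2⟩).trans (encard_boxSplit_inter_le B₀ hu y)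
  have hfin : F.Finite := finite_of_encard_le_coe hF
  have hcard : hfin.toFinset.card ≤ 3 ^ N := by
    rwa [hfin.encard_eq_coe_toFinset_card, Nat.cast_le] at hF
  have hsub : removedNear 𝓑 𝓐 (Metric.closedBall y (B₀.radius / u)) ⊆
      ⋃ B ∈ hfin.toFinset, {A ∈ 𝓐 | A.Inside B} := by
    rintro A ⟨hA, B, hB, hAB, hBY⟩
    exact mem_iUnion₂.2 ⟨B, hfin.mem_toFinset.2 ⟨hB, hBY⟩, hA, hAB⟩
  have hfin' : (⋃ B ∈ hfin.toFinset, {A ∈ 𝓐 | A.Inside B}).Finite :=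
    hfin.toFinset.finite_toSet.biUnion fun B hB => (hb B (hfin.mem_toFinset.1 hB).1).1
  refine ⟨hfin'.subset hsub, ?_⟩
  have h1 := (ncard_le_ncard hsub hfin').trans (Finset.set_ncard_biUnion_le _ _)
  have h2 : ((∑ B ∈ hfin.toFinset, {A ∈ 𝓐 | A.Inside B}.ncard : ℕ) : ℝ) ≤
      ∑ B ∈ hfin.toFinset, b := by
    push_cast
    exact Finset.sum_le_sum fun B hB => (hb B (hfin.mem_toFinset.1 hB).1).2
  rw [Finset.sum_const, nsmul_eq_mul] at h2
  have h3 : (hfin.toFinset.card : ℝ) ≤ 3 ^ N := by exact_mod_cast hcard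
  calc _ ≤ _ := Nat.cast_le.2 h1
    _ ≤ _ := h2
    _ ≤ _ := mul_le_mul_of_nonneg_right h3 hb0

/-- The geometric series that bounds the total size of the removed boxes. -/
theorem tsum_ofReal_mul_pow_le {D q : ℝ} (hD : 0 ≤ D) (hq0 : 0 ≤ q) (hq : q ≤ 1 / 2) :
    ∑' k : ℕ, ENNReal.ofReal (D * q ^ (k + 1)) ≤ ENNReal.ofReal (D * (2 * q)) := by
  have hs : Summable fun k : ℕ => D * q ^ (k + 1) := by
    simp_rw [pow_succ]
    exact ((summable_geometric_of_lt_one hq0 (by linarith)).mul_right q).mul_left D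
  rw [← ENNReal.ofReal_tsum_of_nonneg (fun k => by positivity) hs]
  apply ENNReal.ofReal_le_ofReal
  simp_rw [pow_succ]
  rw [tsum_mul_left, tsum_mul_right, tsum_geometric_of_lt_one hq0 (by linarith)]
  refine mul_le_mul_of_nonneg_left (mul_le_mul_of_nonneg_right ?_ hq0) hD
  rw [inv_le_comm₀ (by linarith) (by norm_num)]
  linarith

section CantorPotential

variable {N : ℕ} {X : Type*} [MetricSpace X]

/-- The ball of `X` that stands for the box `A`. -/
noncomputable def liftBox (ψ : (Fin N → ℝ) → X) {L : ℝ} (hL : 0 < L) (A : CBall (Fin N → ℝ)) :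
    CBall X := ⟨ψ A.center, L * A.radius, mul_pos hL A.radius_pos⟩

/-- The maps `φ` and `ψ` carry boxes to another norm: a box of radius `r` is replaced by a ball of
radius `L * r` containing its preimage. The reply depends on `B₀` because the Cantor set does. -/
theorem exists_potential_reply {φ : X → Fin N → ℝ} {ψ : (Fin N → ℝ) → X} (hφψ : ∀ y, φ (ψ y) = y)
    (hφ : ∀ x y, dist (φ x) (φ y) ≤ dist x y) {L : ℝ} (hL : 0 < L)
    (hψ : ∀ x y, dist x y ≤ L * dist (φ x) (φ y)) {ε₀ ε c β : ℝ} (hε : 0 < ε) (hεε₀ : ε < ε₀)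
    (hc : N * (1 - ε) < c) (hc0 : 0 < c) (hβ : 0 < β) {E : Set (Fin N → ℝ)} (B₀ : CBall X)
    (hE : (standardSplitting N).IsCantorWinningOn ε₀ ⟨φ B₀.center, B₀.radius, B₀.radius_pos⟩ E) :
    ∃ rem : CBall X → Set (CBall X),
      (∀ B, (rem B).Countable ∧ ∑' A : rem B, ENNReal.ofReal ((A : CBall X).radius ^ c) ≤
        ENNReal.ofReal ((β * B.radius) ^ c)) ∧
      ∀ B : ℕ → CBall X, B 0 = B₀ →
        (∀ n, (B (n + 1)).Inside (B n) ∧ β * (B n).radius ≤ (B (n + 1)).radius) →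
        Tendsto (fun n => (B n).radius) atTop (𝓝 0) →
        ∀ x ∈ ⋂ n, (B n).carrier, φ x ∈ E ∨ ∃ n, ∃ A ∈ rem (B n), x ∈ A.carrier := by
  set η := c - N * (1 - ε) with hη_def
  have hη : 0 < η := sub_pos.2 hc
  set B₀' : CBall (Fin N → ℝ) := ⟨φ B₀.center, B₀.radius, B₀.radius_pos⟩ with hB₀'
  obtain ⟨Rε, -, hRε⟩ := hE ε hε hεε₀
  obtain ⟨R, hRR, hR, hRβ, hq2, hDq⟩ :=
    exists_large_parameter (β := β) (η := η) (D := 3 ^ N * L ^ c) (c := c) hβ hη Rε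
  obtain ⟨r, K, hr, ⟨𝓑, 𝓐, h0, h1, h2, h3, hK⟩, hKE⟩ := hRε R hR hRR
  have hR' : (0 : ℝ) < R := by exact_mod_cast hR
  have hR1 : 1 ≤ R := hR
  have hr₀ := B₀.radius_pos
  have h𝓑 : ∀ m, 𝓑 m ⊆ boxSplit B₀' (R ^ m) := fun m =>
    (standardSplitting N).subset_split_pow hR (boxSplit_one B₀') h0
      (fun n => (h1 n).subset.trans sdiff_subset) m
  let t : ℕ → ℝ := fun m => B₀.radius / (R ^ m : ℕ)
  have ht : ∀ m, 0 < t m := fun m => div_pos hr₀ (by exact_mod_cast Nat.pow_pos hR)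
  have hrad : ∀ m k, ∀ A ∈ 𝓐 m (m + k), A.radius = t m / R ^ (k + 1) := by
    intro m k A hA
    obtain ⟨B, hB, hAB⟩ := mem_iUnion₂.1 (h2 m (m + k) (by omega) hA)
    rw [Nat.add_sub_cancel_left] at hAB
    have hB1 := ((standardSplitting N).split_inside B₀' _ (Nat.pow_pos hR) B (h𝓑 m hB)).2
    have hA1 := ((standardSplitting N).split_inside B _ (Nat.pow_pos hR) A hAB).2
    rw [hA1, hB1]
    push_cast
    simp only [t, hB₀', Nat.cast_pow]
  let T : ℕ → ℕ → (Fin N → ℝ) → Set (CBall X) := fun m k y =>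
    liftBox ψ hL '' removedNear (𝓑 m) (𝓐 m (m + k)) (Metric.closedBall y (t m))
  have hT : ∀ m k y, (T m k y).Finite ∧ ∑' A : T m k y, ENNReal.ofReal ((A : CBall X).radius ^ c) ≤
      ENNReal.ofReal (3 ^ N * L ^ c * t m ^ c * ((R : ℝ) ^ (-η)) ^ (k + 1)) := by
    intro m k y
    have hr1 := hr m (m + k) (by omega)
    obtain ⟨hf, hcard⟩ := removedNear_finite_and_ncard_le (Nat.pow_pos hR) (h𝓑 m)
      (h3 m (m + k) (by omega)) hr1.1 y
    refine ⟨hf.image _, ?_⟩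
    have hcard' : ((T m k y).ncard : ℝ) ≤ 3 ^ N * r m (m + k) :=
      (Nat.cast_le.2 (ncard_image_le hf)).trans hcard
    refine (tsum_radius_rpow_le (ρ := L * (t m / R ^ (k + 1))) (hf.image _) hcard'
      (mul_nonneg hL.le (div_nonneg (ht m).le (by positivity))) ?_).trans ?_
    · rintro _ ⟨A, hA, rfl⟩
      simp only [liftBox, hrad m k A hA.1]
    · apply ENNReal.ofReal_le_ofReal
      have hb : r m (m + k) ≤ ((R : ℝ) ^ ((N : ℝ) * (1 - ε))) ^ (k + 1) := by
        refine hr1.2.trans_eq ?_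
        have : (((standardSplitting N).f R : ℕ) : ℝ) = (R : ℝ) ^ (N : ℝ) := by
          rw [Real.rpow_natCast]
          exact_mod_cast rfl
        rw [this, ← Real.rpow_mul hR'.le, ← Real.rpow_natCast, ← Real.rpow_mul hR'.le]
        congr 1
        push_cast
        ring
      have hpow : (L * (t m / R ^ (k + 1))) ^ c = L ^ c * t m ^ c * ((R : ℝ) ^ (-c)) ^ (k + 1) := by
        rw [Real.mul_rpow hL.le (div_nonneg (ht m).le (by positivity)),
          Real.div_rpow (ht m).le (by positivity), ← Real.rpow_natCast, ← Real.rpow_natCast,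
          ← Real.rpow_mul hR'.le, ← Real.rpow_mul hR'.le, neg_mul, Real.rpow_neg hR'.le,
          mul_comm c, div_eq_mul_inv, mul_assoc]
      have hη' : ((R : ℝ) ^ (-η)) ^ (k + 1) =
          ((R : ℝ) ^ ((N : ℝ) * (1 - ε))) ^ (k + 1) * ((R : ℝ) ^ (-c)) ^ (k + 1) := by
        rw [← mul_pow, ← Real.rpow_add hR', hη_def]
        congr 2
        ring
      rw [hpow, hη']
      have hLt : 0 ≤ L ^ c * t m ^ c * ((R : ℝ) ^ (-c)) ^ (k + 1) := by
        have := ht m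
        positivity
      calc _ ≤ 3 ^ N * ((R : ℝ) ^ ((N : ℝ) * (1 - ε))) ^ (k + 1) *
            (L ^ c * t m ^ c * ((R : ℝ) ^ (-c)) ^ (k + 1)) := by gcongr
        _ = _ := by ring
  -- Alice handles level `m` when Bob's radius is in this window. The windows are disjoint because
  -- `1 < R * β`, so each budget pays for one level only.
  let valid : ℕ → CBall X → Prop := fun m B => β * t m ≤ B.radius ∧ B.radius ≤ t m
  have hstep : ∀ m m' B, m < m' → valid m B → valid m' B → False := by
    intro m m' B hm hv hv'
    obtain ⟨d, rfl⟩ := Nat.exists_eq_add_of_lt hm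
    have h4 : t (m + d + 1) * R ≤ t m := by
      have h5 : t (m + d + 1) * R = t m / R ^ d := by
        simp only [t]
        push_cast
        field_simp
        ring
      rw [h5]
      exact div_le_self (ht m).le (one_le_pow₀ (by exact_mod_cast hR1))
    have h5 : β * (t (m + d + 1) * R) ≤ t (m + d + 1) :=
      ((mul_le_mul_of_nonneg_left h4 hβ.le).trans hv.1).trans hv'.2
    have := ht (m + d + 1)
    nlinarith
  have huniq : ∀ m m' B, valid m B → valid m' B → m = m' := by
    intro m m' B hv hv'
    rcases lt_trichotomy m m' with h | h | h
    · exact (hstep m m' B h hv hv').elim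
    · exact h
    · exact (hstep m' m B h hv' hv).elim
  let rem : CBall X → Set (CBall X) := fun B => ⋃ (m) (_ : valid m B), ⋃ k, T m k (φ B.center)
  refine ⟨rem, fun B => ?_, fun B hB0 hB hlim x hx => ?_⟩
  · refine ⟨countable_iUnion fun m => countable_iUnion fun _ => countable_iUnion fun k =>
      (hT m k _).1.countable, ?_⟩
    by_cases hv : ∃ m, valid m B
    · obtain ⟨m, hm⟩ := hv
      have hrem : rem B = ⋃ k, T m k (φ B.center) := by
        refine subset_antisymm (iUnion₂_subset fun m' hm' => ?_)
          (subset_iUnion₂_of_subset m hm subset_rfl)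
        rw [huniq m' m B hm' hm]
      rw [hrem]
      refine (ENNReal.tsum_iUnion_le_tsum (fun A : CBall X => ENNReal.ofReal (A.radius ^ c))
        fun k => T m k (φ B.center)).trans ?_
      refine (ENNReal.tsum_le_tsum fun k => (hT m k _).2).trans ?_
      have htm := ht m
      refine (tsum_ofReal_mul_pow_le (by positivity) (by positivity) hq2).trans ?_
      apply ENNReal.ofReal_le_ofReal
      have h6 : 3 ^ N * L ^ c * t m ^ c * (2 * (R : ℝ) ^ (-η)) ≤ β ^ (2 * c) * t m ^ c := by
        have := mul_le_mul_of_nonneg_right hDq (show 0 ≤ t m ^ c by positivity)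
        linarith
      refine h6.trans ?_
      -- One factor `β ^ c` comes from Alice's budget, the other from `β * t m ≤ B.radius`.
      rw [two_mul, Real.rpow_add hβ, mul_assoc, ← Real.mul_rpow hβ.le htm.le,
        ← Real.mul_rpow hβ.le (by positivity)]
      exact Real.rpow_le_rpow (by positivity) (mul_le_mul_of_nonneg_left hm.1 hβ.le) hc0.le
    · have hrem : rem B = ∅ := by
        refine eq_empty_of_forall_notMem fun A hA => ?_
        obtain ⟨m, hm, -⟩ := mem_iUnion₂.1 hA
        exact hv ⟨m, hm⟩
      rw [hrem, tsum_empty]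
      exact zero_le
  · have hx' : ∀ n, dist x (B n).center ≤ (B n).radius := fun n => mem_iInter.1 hx n
    by_cases hxK : φ x ∈ K
    · exact Or.inl (hKE hxK)
    · right
      have hx0 : φ x ∈ B₀'.carrier := by
        have := hx' 0
        rw [hB0] at this
        exact (hφ _ _).trans this
      rw [hK] at hxK
      obtain ⟨m, n, hmn, A, hA, D, hD, hAD, hxA⟩ :=
        mem_removed_of_notMem_cantorSet hR h0 h1 h2 hx0 hxK
      obtain ⟨k, rfl⟩ := Nat.exists_eq_add_of_le hmn
      have htm : t m ≤ (B 0).radius := by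
        rw [hB0]
        exact div_le_self hr₀.le (by exact_mod_cast Nat.one_le_pow _ _ hR)
      obtain ⟨i, hi⟩ := exists_radius_mem_Icc (r := fun n => (B n).radius) hβ
        (fun n => (hB n).1.radius_le) (fun n => (hB n).2) hlim (ht m) htm
      refine ⟨i, liftBox ψ hL A, mem_iUnion₂.2 ⟨m, hi, mem_iUnion.2 ⟨k, A, ?_, rfl⟩⟩, ?_⟩
      · exact ⟨hA, D, hD, hAD, φ x, hAD.carrier_subset hxA,
          ((hφ _ _).trans (hx' i)).trans hi.2⟩
      · refine (hψ _ _).trans ?_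
        rw [liftBox, hφψ]
        exact mul_le_mul_of_nonneg_left hxA hL.le

theorem SplittingStructure.IsCantorWinning.isPotentialWinning_preimage (hN : 0 < N)
    {φ : X → Fin N → ℝ}
    {ψ : (Fin N → ℝ) → X} (hφψ : ∀ y, φ (ψ y) = y) (hφ : ∀ x y, dist (φ x) (φ y) ≤ dist x y)
    {L : ℝ} (hL : 0 < L) (hψ : ∀ x y, dist x y ≤ L * dist (φ x) (φ y)) {E : Set (Fin N → ℝ)}
    (hE : (standardSplitting N).IsCantorWinning E) :
    IsPotentialWinning (N : ℝ) (φ ⁻¹' E) := by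
  obtain ⟨ε₀, hε₀, hε₀1, hE⟩ := hE
  have hN' : (0 : ℝ) < N := by exact_mod_cast hN
  refine ⟨N * (1 - ε₀), mul_nonneg hN'.le (by linarith), by nlinarith, fun c β hc hβ => ?_⟩
  have hc0 : 0 < c := lt_of_le_of_lt (mul_nonneg hN'.le (by linarith)) hc
  have hlt : 1 - c / N < ε₀ := by
    have : 1 - ε₀ < c / N := by
      rw [lt_div_iff₀ hN']
      linarith
    linarith
  obtain ⟨ε, hε1, hε2⟩ := exists_between (max_lt hε₀ hlt)
  have hcε : N * (1 - ε) < c := by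
    have h1 : 1 - ε < c / N := by linarith [(le_max_right 0 (1 - c / N)).trans_lt hε1]
    rw [lt_div_iff₀ hN'] at h1
    linarith
  choose rem h1 h2 using fun B₀ : CBall X => exists_potential_reply hφψ hφ hL hψ
    ((le_max_left _ _).trans_lt hε1) hε2 hcε hc0 hβ B₀ (hE _)
  refine ⟨fun n h => rem (h 0) (h (Fin.last n)), fun n h => h1 _ _, fun B hB => ?_⟩
  by_cases hlim : Tendsto (fun n => (B n).radius) atTop (𝓝 0)
  swap
  · exact Or.inl hlim
  right
  by_cases hx : ∃ x, x ∈ ⋂ n, (B n).carrier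
  swap
  · exact Or.inl fun x hx' => absurd ⟨x, hx'⟩ hx
  obtain ⟨x, hx⟩ := hx
  -- The outcome is a single point, so the alternative for `x` becomes an alternative between
  -- inclusions.
  have hsub : ∀ y ∈ ⋂ n, (B n).carrier, y = x := by
    intro y hy
    have h3 : ∀ n, dist y x ≤ 2 * (B n).radius := fun n => by
      have h4 : dist y (B n).center ≤ (B n).radius := mem_iInter.1 hy n
      have h5 : dist x (B n).center ≤ (B n).radius := mem_iInter.1 hx n
      have := dist_triangle_right y x (B n).center
      linarith
    have h6 := ge_of_tendsto' (by simpa using hlim.const_mul 2) h3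
    exact dist_le_zero.1 h6
  rcases h2 (B 0) B rfl hB hlim x hx with hxE | ⟨n, A, hA, hxA⟩
  · right
    intro y hy
    rw [hsub y hy]
    exact hxE
  · left
    intro y hy
    rw [hsub y hy]
    exact mem_iUnion.2 ⟨n, mem_iUnion₂.2 ⟨A, by simpa using hA, hxA⟩⟩

end CantorPotential

/-! ### Euclidean and maximum norms -/

/-- Haar measure scales exactly; `C` only has to dominate the volume `v` of the unit ball and its
inverse. -/
theorem isAhlforsRegular_finrank {V : Type*} [NormedAddCommGroup V] [NormedSpace ℝ V]
    [FiniteDimensional ℝ V] [MeasurableSpace V] [BorelSpace V] (h : 0 < Module.finrank ℝ V) :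
    IsAhlforsRegular V (Module.finrank ℝ V : ℝ) := by
  let μ : Measure V := Measure.addHaar
  set v := (μ (Metric.ball (0 : V) 1)).toReal
  have hvtop : μ (Metric.ball (0 : V) 1) ≠ ⊤ := measure_ball_lt_top.ne
  have hv : 0 < v := ENNReal.toReal_pos (Metric.measure_ball_pos μ 0 one_pos).ne' hvtop
  have hC : 0 < max v v⁻¹ := lt_max_of_lt_left hv
  refine ⟨by exact_mod_cast h, μ, max v v⁻¹, 1, hC, one_pos, fun x r hr _ => ?_⟩
  have hball : μ (Metric.closedBall x r) =
      ENNReal.ofReal (v * r ^ (Module.finrank ℝ V : ℝ)) := by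
    rw [Measure.addHaar_closedBall μ x hr.le, ← ENNReal.ofReal_toReal hvtop,
      ← ENNReal.ofReal_mul (by positivity), mul_comm, Real.rpow_natCast]
  rw [hball]
  constructor
  · apply ENNReal.ofReal_le_ofReal
    refine mul_le_mul_of_nonneg_right ?_ (by positivity)
    rw [one_div, inv_le_comm₀ hC hv]
    exact le_max_right _ _
  · apply ENNReal.ofReal_le_ofReal
    exact mul_le_mul_of_nonneg_right (le_max_left _ _) (by positivity)

theorem dimH_inter_preimage_of_isCantorWinning {N : ℕ} {V : Type*} [NormedAddCommGroup V]
    [NormedSpace ℝ V] [FiniteDimensional ℝ V] (hV : Module.finrank ℝ V = N)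
    {φ : V → Fin N → ℝ}
    {ψ : (Fin N → ℝ) → V} (hφψ : ∀ y, φ (ψ y) = y) (hφ : ∀ x y, dist (φ x) (φ y) ≤ dist x y)
    {L : ℝ} (hL : 0 < L) (hψ : ∀ x y, dist x y ≤ L * dist (φ x) (φ y)) {S : Set V}
    {E : Set (Fin N → ℝ)} (hS : IsWinning S ∨ IsWeakWinning S)
    (hE : (standardSplitting N).IsCantorWinning E) : dimH (S ∩ φ ⁻¹' E) = (N : ℝ≥0∞) := by
  borelize V
  -- Ahlfors regularity demands a positive exponent, so the one-point space is treated apart.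
  rcases Nat.eq_zero_or_pos N with rfl | hN
  · have := Module.finrank_zero_iff.1 hV
    rw [dimH_subsingleton (subsingleton_of_subsingleton), Nat.cast_zero]
  · have hreg := isAhlforsRegular_finrank (V := V) (hV ▸ hN)
    rw [hV] at hreg
    have := FiniteDimensional.complete ℝ V
    have := FiniteDimensional.proper ℝ V
    have h := (hreg.dimH_inter (hS.elim IsWinning.isWeakWinning id)
      (hE.isPotentialWinning_preimage hN hφψ hφ hL hψ)).2 inferInstance
    rw [h, ENNReal.ofReal_natCast]

theorem dist_ofLp_le {N : ℕ} (x y : EuclideanSpace ℝ (Fin N)) :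
    dist (WithLp.ofLp x) (WithLp.ofLp y) ≤ dist x y := by
  simpa using (PiLp.lipschitzWith_ofLp 2 fun _ : Fin N => ℝ).dist_le_mul x y

/-- The summand `1` keeps the constant positive when `N = 0`. -/
theorem dist_le_mul_dist_ofLp {N : ℕ} (x y : EuclideanSpace ℝ (Fin N)) :
    dist x y ≤ (√N + 1) * dist (WithLp.ofLp x) (WithLp.ofLp y) := by
  have h := (PiLp.antilipschitzWith_ofLp 2 fun _ : Fin N => ℝ).le_mul_dist x y
  refine h.trans (mul_le_mul_of_nonneg_right ?_ dist_nonneg)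
  simp [Real.sqrt_eq_rpow]

theorem mainTheorem6 :
    (∀ (N : ℕ) (S E : Set (Fin N → ℝ)), (IsWinning S ∨ IsWeakWinning S) →
      (standardSplitting N).IsCantorWinning E → dimH (S ∩ E) = (N : ℝ≥0∞)) ∧
    (∀ (N : ℕ) (S : Set (EuclideanSpace ℝ (Fin N))) (E : Set (Fin N → ℝ)),
      (IsWinning S ∨ IsWeakWinning S) → (standardSplitting N).IsCantorWinning E →
      dimH (S ∩ {x | WithLp.ofLp x ∈ E}) = (N : ℝ≥0∞)) ∧
    (∀ (X : Type*) [MetricSpace X] [CompleteSpace X] [Nonempty X] [MeasurableSpace X]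
      [BorelSpace X] (δ : ℝ) (S E : Set X), IsAhlforsRegular X δ →
      (IsWinning S ∨ IsWeakWinning S) → IsPotentialWinning δ E →
      dimH (S ∩ E) = dimH (univ : Set X) ∧
      (TopologicalSpace.SeparableSpace X → dimH (S ∩ E) = ENNReal.ofReal δ)) := by
  refine ⟨fun N S E hS hE => ?_, fun N S E hS hE => ?_, ?_⟩
  · exact dimH_inter_preimage_of_isCantorWinning (φ := id) (ψ := id) (L := 1) (by simp)
      (fun _ => rfl) (fun _ _ => le_rfl) one_pos (fun _ _ => (one_mul _).ge) hS hE
  · exact dimH_inter_preimage_of_isCantorWinning (φ := WithLp.ofLp) (ψ := WithLp.toLp 2)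
      (by simp) (fun _ => rfl) dist_ofLp_le (by positivity) dist_le_mul_dist_ofLp hS hE
  · intro X _ _ _ _ _ δ S E hX hS hE
    exact hX.dimH_inter (hS.elim IsWinning.isWeakWinning id) hE
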